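/- Let $\mathbb{F}_q$ be a fixed finite field with $q\equiv 1\pmod 4$ elements and let $A=\mathbb{F}_q[T]$. For a nonzero $f\in A$ put $|f|=q^{\deg f}$. For $g\ge 0$ let $\mathcal{H}_{2g+1,q}$ be the set of all monic square-free $D\in A$ of degree $2g+1$. For $D\in\mathcal{H}_{2g+1,q}$ and monic $f\in A$ let $\chi_D(f)=\left(\frac{D}{f}\right)$ be the quadratic residue symbol: for $P$ monic irreducible, $\left(\frac{D}{P}\right)$ is $0$ if $P\mid D$, $1$ if $D$ is a nonzero square modulo $P$, and $-1$ otherwise, and the symbol is extended multiplicatively to all monic $f$. Let $$L(s,\chi_D)=\sum_{n\ge 0}\ \sum_{\substack{f\ \mathrm{monic}\\ \deg f=n}}\frac{\chi_D(f)}{|f|^{s}},\qquad \zeta_A(s)=\sum_{f\ \mathrm{monic}}\frac{1}{|f|^{s}},\qquad P(s)=\prod_{\substack{P\ \mathrm{monic}\\ \mathrm{irreducible}}}\left(1-\frac{1}{(|P|+1)|P|^{s}}\right).$$ Then the series $L(1,\chi_D)$ (summed by degree) converges for every $g\ge 0$ and every $D\in\mathcal{H}_{2g+1,q}$, the series $\zeta_A(2)$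 and the product $P(2)$ converge unconditionally, and $$\frac{1}{\#\mathcal{H}_{2g+1,q}}\sum_{D\in\mathcal{H}_{2g+1,q}}L(1,\chi_D)\ \sim\ \zeta_A(2)\,P(2)\qquad (g\to\infty).$$ -/

import Mathlib

open Polynomial

noncomputable section

namespace FqT

variable {F : Type*} [Field F] [Fintype F]

/-- The norm `|f| = q ^ deg f` of a nonzero polynomial over the finite field `F` with `q` elements. -/
def polyNorm (f : F[X]) : ℕ := Fintype.card F ^ f.natDegree

variable (F) in
theorem finite_monic_natDegree_eq (n : ℕ) : {f : F[X] | f.Monic ∧ f.natDegree = n}.Finite := by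
  have : Finite (degreeLT F n) := Finite.of_equiv _ (degreeLTEquiv F n).toEquiv.symm
  exact Finite.of_equiv _ (monicEquivDegreeLT n).symm

variable (F) in
/-- The monic polynomials of degree `n` over `F`. -/
def monicOfDegree (n : ℕ) : Finset F[X] := (finite_monic_natDegree_eq F n).toFinset

theorem mem_monicOfDegree {n : ℕ} {f : F[X]} :
    f ∈ monicOfDegree F n ↔ f.Monic ∧ f.natDegree = n := by
  simp [monicOfDegree]

open Classical in
variable (F) in
/-- The square-free monic polynomials of degree `n` over `F`. The family of the hyperelliptic
curves of genus `g` with one point at infinity is `squarefreeMonic F (2 * g + 1)`. -/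
def squarefreeMonic (n : ℕ) : Finset F[X] := (monicOfDegree F n).filter Squarefree

open Classical in
/-- The quadratic residue symbol `(D / P)` for a monic irreducible `P`: it is `0` if `P` divides `D`,
`1` if `D` is a nonzero square modulo `P`, and `-1` otherwise. -/
def residueSymbol (D P : F[X]) : ℤ := quadraticCharFun (AdjoinRoot P) (AdjoinRoot.mk P D)

open Classical in
/-- The quadratic character `χ_D (f) = (D / f)` at a monic `f`: the quadratic residue symbol, extended
multiplicatively from the monic irreducible factors of `f`, counted with multiplicity. -/
def chi (D f : F[X]) : ℤ :=
  ((UniqueFactorizationMonoid.normalizedFactors f).map (residueSymbol D)).prod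

/-- The part of degree `n` of the Dirichlet series of `χ_D`:
the sum of `χ_D (f) / |f| ^ s` over the monic `f` of degree `n`. -/
def LTerm (D : F[X]) (s : ℂ) (n : ℕ) : ℂ :=
  ∑ f ∈ monicOfDegree F n, (chi D f : ℂ) / (polyNorm f : ℂ) ^ s

/-- `L(s, χ_D) = ∑_{f monic} χ_D (f) / |f| ^ s`, summed by degree. For `Re s > 1` the series over
all monic `f` converges absolutely and the grouping is immaterial; elsewhere the grouped series is the
polynomial in `q ^ (-s)` that is meant by `L(s, χ_D)`. -/
def LFunction (D : F[X]) (s : ℂ) : ℂ := ∑' n : ℕ, LTerm D s n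

variable (F) in
/-- `ζ_A(s) = ∑_{f monic} 1 / |f| ^ s` for `A = F[T]`. -/
def zetaA (s : ℂ) : ℂ := ∑' f : {f : F[X] // f.Monic}, 1 / (polyNorm f.1 : ℂ) ^ s

/-- The Euler factor `1 - 1 / ((|P| + 1) |P| ^ s)`. -/
def eulerFactor (s : ℂ) (P : {P : F[X] // P.Monic ∧ Irreducible P}) : ℂ :=
  1 - 1 / (((polyNorm P.1 : ℂ) + 1) * (polyNorm P.1 : ℂ) ^ s)

variable (F) in
/-- `P(s) = ∏_{P monic irreducible} (1 - 1 / ((|P| + 1) |P| ^ s))`. -/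
def eulerP (s : ℂ) : ℂ := ∏' P : {P : F[X] // P.Monic ∧ Irreducible P}, eulerFactor s P

end FqT

end

set_option linter.unusedSectionVars false

noncomputable section

namespace FqT

variable {F : Type*} [Field F] [Fintype F]

/-! Write `L(1, χ_D)` as the sum over `n` of `A_n(D) / q ^ n`, where `A_n(D)` sums `χ_D` over monic
`f` of degree `n`. The mean over `D` is computed termwise in `n`, and the limit `g → ∞` is exchanged
with the sum over `n` by dominated convergence.

Termwise limit: for fixed non-square `f` the mean of `χ_D(f)` tends to `0`
(`tendsto_sum_squarefree_jac_of_not_isSquare`). For `f = l ^ 2` it is the probability that `D` is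
coprime to `l`, which tends to the product of `|P| / (|P| + 1)` over `P ∣ l`
(`tendsto_coprimeCount`). Summing this density over `|l| ^ 2` gives `ζ_A(2) P(2)`
(`tsum_coprimeDensity`).

Domination: the mean of `|A_n| / q ^ n` is at most `√(2 (n + 1) / q ^ n)`, uniformly in `g`
(`abs_meanTerm_le`). For `n ≤ g` this is Cauchy–Schwarz and a second moment over all monic `D`,
where only pairs with `f₁ f₂` a square survive. For `g < n ≤ 2g` the functional equation, proved
with Gauss sums, reflects `n` to `2g - n`. For `n > 2g` the term is zero.

The symbol is handled as the quadratic character of a resultant, so that multiplicativity,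
periodicity and reciprocity (where `q ≡ 1 mod 4` enters) are properties of resultants. -/

/-! ### The symbol as a character of the resultant, and reciprocity -/

open Classical in
/-- The Jacobi symbol `(a / b)` for a monic `b`, as the quadratic character of the resultant. -/
def jac (a b : F[X]) : ℤ := quadraticChar F (resultant b a)

/-- Raising the nominal degree of `a` only multiplies the resultant by a power of the leading
coefficient of `b`. -/
theorem resultant_eq_of_monic {a b : F[X]} (hb : b.Monic) {n : ℕ} (hn : a.natDegree ≤ n) :
    resultant b a b.natDegree n = resultant b a := by
  obtain ⟨k, rfl⟩ := Nat.exists_eq_add_of_le hn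
  rw [resultant_add_right_deg _ _ _ _ _ le_rfl, coeff_natDegree, hb.leadingCoeff, one_pow, one_mul]

theorem jac_mul_left (a a' : F[X]) {b : F[X]} (hb : b.Monic) :
    jac (a * a') b = jac a b * jac a' b := by
  rw [jac, jac, jac, ← map_mul, ← resultant_mul_right b a a' _ le_rfl,
    resultant_eq_of_monic hb natDegree_mul_le]

theorem jac_mul_right (a : F[X]) {b b' : F[X]} (hb : b.Monic) (hb' : b'.Monic) :
    jac a (b * b') = jac a b * jac a b' := by
  rw [jac, jac, jac, ← map_mul, ← resultant_mul_left b b' a _ le_rfl, hb.natDegree_mul hb']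

theorem jac_congr {a a' b : F[X]} (hb : b.Monic) (h : b ∣ a - a') : jac a b = jac a' b := by
  obtain ⟨p, hp⟩ := h
  obtain rfl : a = a' + b * p := by rw [← hp]; ring
  rw [jac, jac, ← resultant_eq_of_monic (n := max (a' + b * p).natDegree
    (max a'.natDegree (p.natDegree + b.natDegree))) hb (le_max_left _ _),
    resultant_add_mul_right _ _ _ _ _ (by simp) le_rfl, resultant_eq_of_monic hb (by simp)]

/-- Swapping the arguments of a resultant costs a sign, and `-1` is a square when `q ≡ 1 mod 4`. -/
theorem jac_comm (hq : Fintype.card F % 4 = 1) (a b : F[X]) : jac a b = jac b a := by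
  classical
  have h : IsSquare (-1 : F) := by
    rw [FiniteField.isSquare_neg_one_iff]; omega
  rw [jac, jac, resultant_comm, map_mul, map_pow, (quadraticChar_one_iff_isSquare (by simp)).2 h]
  simp

@[simp] theorem jac_one_right (a : F[X]) : jac a 1 = 1 := by simp [jac]

@[simp] theorem jac_one_left (b : F[X]) : jac 1 b = 1 := by
  simp [jac]

theorem jac_C [DecidableEq F] (b : F[X]) (c : F) :
    jac (C c) b = quadraticChar F c ^ b.natDegree := by
  rw [jac, resultant_C_right, natDegree_C, pow_zero, one_mul, map_pow]
  congr!

theorem jac_eq_zero_iff {a b : F[X]} (hb : b.Monic) : jac a b = 0 ↔ ¬ IsCoprime b a := by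
  classical
  rw [jac, quadraticChar_eq_zero_iff, resultant_eq_zero_iff]
  simp [hb.ne_zero]

theorem jac_sq_of_isCoprime {a b : F[X]} (hb : b.Monic) (h : IsCoprime b a) : jac a b ^ 2 = 1 := by
  classical
  have h' : jac a b ≠ 0 := by rwa [Ne, jac_eq_zero_iff hb, not_not]
  exact quadraticChar_sq_one (mt quadraticChar_eq_zero_iff.2 h')

theorem jac_eq (a b : F[X]) : jac a b = 0 ∨ jac a b = 1 ∨ jac a b = -1 := by
  classical
  exact quadraticChar_isQuadratic F _

theorem abs_jac_le_one (a b : F[X]) : |jac a b| ≤ 1 := by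
  rcases jac_eq a b with h | h | h <;> simp [h]

/-! ### Agreement with the quadratic residue symbol -/

/-- Over the algebraic closure both sides are the product of the values of `a` at the roots of `P`;
the roots are simple because `F` is perfect, so they match the embeddings. -/
theorem algebraNorm_mk_eq_resultant {P : F[X]} (hP : P.Monic) (hi : Irreducible P) (a : F[X]) :
    haveI := Fact.mk hi
    Algebra.norm F (AdjoinRoot.mk P a) = resultant P a := by
  have := Fact.mk hi
  let E := AlgebraicClosure F
  let pb := AdjoinRoot.powerBasis hP.ne_zero
  have hfin : Module.Finite F (AdjoinRoot P) := pb.finite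
  have hmin : minpoly F pb.gen = P := AdjoinRoot.minpoly_powerBasis_gen_of_monic hP
  apply (algebraMap F E).injective
  rw [Algebra.norm_eq_prod_embeddings F E, ← resultant_map_map,
    ← natDegree_map (p := P) (algebraMap F E),
    resultant_eq_prod_eval _ _ _ natDegree_map_le (IsAlgClosed.splits _),
    (hP.map _).leadingCoeff, one_pow, one_mul]
  classical
  have hsep : (P.map (algebraMap F E)).Separable :=
    (PerfectField.separable_of_irreducible hi).map
  rw [Fintype.prod_equiv pb.liftEquiv' _ (fun x => (a.map (algebraMap F E)).eval x.1)]
  · rw [Finset.prod_mem_multiset _ _ (fun x => (a.map (algebraMap F E)).eval x) (fun x => rfl),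
      hmin, Finset.prod_eq_multiset_prod, Multiset.toFinset_val,
      Multiset.dedup_eq_self.mpr (nodup_roots hsep)]
  · intro σ
    rw [PowerBasis.liftEquiv'_apply_coe, eval_map_algebraMap]
    have h1 : AdjoinRoot.mk P a = aeval pb.gen a := by
      simp [pb, AdjoinRoot.aeval_eq]
    rw [h1, ← aeval_algHom_apply]

theorem ringChar_ne_two_of_card (hq : Fintype.card F % 4 = 1) : ringChar F ≠ 2 := by
  intro h
  have := FiniteField.even_card_of_char_two h
  omega

theorem finite_adjoinRoot {P : F[X]} (hP : P.Monic) : Finite (AdjoinRoot P) := by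
  have := hP.finite_adjoinRoot
  exact Module.finite_of_finite F

theorem card_adjoinRoot {P : F[X]} (hP : P.Monic) : Nat.card (AdjoinRoot P) = polyNorm P := by
  have := hP.finite_adjoinRoot
  rw [Module.natCard_eq_pow_finrank (K := F), (AdjoinRoot.powerBasis' hP).finrank]
  simp [polyNorm]

/-- Euler's criterion on both sides: with `d = deg P`, the norm is the power `(q ^ d - 1) / (q -
1)`, and raising it to `(q - 1) / 2` gives the power `(q ^ d - 1) / 2`. -/
theorem residueSymbol_eq_jac (hF : ringChar F ≠ 2) {P : F[X]} (hP : P.Monic) (hi : Irreducible P)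
    (a : F[X]) : residueSymbol a P = jac a P := by
  classical
  have := Fact.mk hi
  have := finite_adjoinRoot hP
  let _ := Fintype.ofFinite (AdjoinRoot P)
  have hK : ringChar (AdjoinRoot P) ≠ 2 := by
    rwa [← Algebra.ringChar_eq F (AdjoinRoot P)]
  have key : quadraticChar (AdjoinRoot P) (AdjoinRoot.mk P a) = quadraticChar F (resultant P a) := by
    rw [← algebraNorm_mk_eq_resultant hP hi]
    set x := AdjoinRoot.mk P a
    have hinj : ((quadraticChar (AdjoinRoot P) x : ℤ) : AdjoinRoot P) =
        ((quadraticChar F (Algebra.norm F x) : ℤ) : AdjoinRoot P) := by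
      rw [quadraticChar_eq_pow_of_char_ne_two' hK,
        ← map_intCast (algebraMap F (AdjoinRoot P)) (quadraticChar F _),
        quadraticChar_eq_pow_of_char_ne_two' hF, map_pow, FiniteField.algebraMap_norm_eq_pow,
        ← pow_mul]
      congr 1
      have hc := card_adjoinRoot hP
      rw [Nat.card_eq_fintype_card] at hc ⊢
      rw [Nat.card_eq_fintype_card, hc, polyNorm]
      set q := Fintype.card F
      have ho : q % 2 = 1 := FiniteField.odd_card_of_char_ne_two hF
      have hq1 : 1 < q := Fintype.one_lt_card
      obtain ⟨k, hk⟩ : q - 1 ∣ q ^ P.natDegree - 1 := Nat.sub_one_dvd_pow_sub_one q _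
      have ho' : q ^ P.natDegree % 2 = 1 := by
        rw [Nat.pow_mod, ho]; simp
      rw [hk, Nat.mul_div_cancel_left _ (by omega)]
      obtain ⟨r, hr⟩ : ∃ r, q = 2 * r + 1 := ⟨q / 2, by omega⟩
      have h3 : q / 2 = r := by omega
      have h2 : q - 1 = 2 * r := by omega
      rw [h2] at hk
      rw [h3]
      have : q ^ P.natDegree = 2 * (r * k) + 1 := by
        have := Nat.pos_of_ne_zero (pow_ne_zero P.natDegree (by omega : q ≠ 0))
        rw [← mul_assoc]; omega
      rw [this, mul_comm k]; omega
    -- In characteristic other than `2` the values `0, 1, -1` stay distinct in the residue field.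
    have hd : ∀ z : ℤ, (z = 0 ∨ z = 1 ∨ z = -1) → ∀ w : ℤ, (w = 0 ∨ w = 1 ∨ w = -1) →
        (z : AdjoinRoot P) = w → z = w := by
      have h1 : (1 : AdjoinRoot P) ≠ 0 := one_ne_zero
      have h2 : (-1 : AdjoinRoot P) ≠ 1 := Ring.neg_one_ne_one_of_char_ne_two hK
      rintro z (rfl | rfl | rfl) w (rfl | rfl | rfl) h <;> push_cast at h
      · rfl
      · exact (h1 h.symm).elim
      · exact (neg_ne_zero.2 h1 h.symm).elim
      · exact (h1 h).elim
      · rfl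
      · exact (h2 h.symm).elim
      · exact (neg_ne_zero.2 h1 h).elim
      · exact (h2 h).elim
      · rfl
    exact hd _ (quadraticChar_isQuadratic _ _) _ (quadraticChar_isQuadratic _ _) hinj
  rw [residueSymbol, jac]
  convert key using 1
  congr

theorem monic_prod_of_forall {s : Multiset F[X]} (h : ∀ p ∈ s, p.Monic) : s.prod.Monic := by
  simpa using monic_multiset_prod_of_monic s id h

theorem jac_multiset_prod (a : F[X]) (s : Multiset F[X]) (h : ∀ p ∈ s, p.Monic) :
    jac a s.prod = (s.map (jac a)).prod := by
  induction s using Multiset.induction with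
  | empty => simp
  | cons p s ih =>
    have hs : ∀ p ∈ s, p.Monic := fun p hp => h p (by simp [hp])
    rw [Multiset.prod_cons, jac_mul_right a (h p (by simp)) (monic_prod_of_forall hs), ih hs]
    simp

theorem monic_of_mem_normalizedFactors [DecidableEq F] {f p : F[X]}
    (h : p ∈ UniqueFactorizationMonoid.normalizedFactors f) : p.Monic := by
  rw [← UniqueFactorizationMonoid.normalize_normalized_factor p h]
  exact monic_normalize (UniqueFactorizationMonoid.irreducible_of_normalized_factor p h).ne_zero

theorem chi_eq_jac (hF : ringChar F ≠ 2) (a : F[X]) {f : F[X]} (hf : f.Monic) :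
    chi a f = jac a f := by
  classical
  have hp : (UniqueFactorizationMonoid.normalizedFactors f).prod = f := by
    rw [UniqueFactorizationMonoid.prod_normalizedFactors_eq hf.ne_zero, hf.normalize_eq_self]
  have key : ((UniqueFactorizationMonoid.normalizedFactors f).map (residueSymbol a)).prod
      = jac a f := by
    conv_rhs => rw [← hp]
    rw [jac_multiset_prod _ _ fun p hp => monic_of_mem_normalizedFactors hp]
    congr 1
    refine Multiset.map_congr rfl fun p hp => ?_
    exact residueSymbol_eq_jac hF (monic_of_mem_normalizedFactors hp)
      (UniqueFactorizationMonoid.irreducible_of_normalized_factor p hp) a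
  rw [chi]
  convert key

/-! ### Nontriviality of the symbol -/

/-- A residue class modulo `P` that is a nonresidue, prescribed to be `1` modulo a coprime `E`. -/
theorem exists_jac_eq_neg_one (hF : ringChar F ≠ 2) {P E : F[X]} (hP : P.Monic)
    (hi : Irreducible P) (h : IsCoprime P E) : ∃ b, E ∣ b - 1 ∧ jac b P = -1 := by
  classical
  have := Fact.mk hi
  have := finite_adjoinRoot hP
  let _ := Fintype.ofFinite (AdjoinRoot P)
  have hK : ringChar (AdjoinRoot P) ≠ 2 := by
    rwa [← Algebra.ringChar_eq F (AdjoinRoot P)]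
  obtain ⟨x, hx⟩ := quadraticChar_exists_neg_one hK
  obtain ⟨c, rfl⟩ := AdjoinRoot.mk_surjective x
  have hc : jac c P = -1 := by
    rw [← residueSymbol_eq_jac hF hP hi, residueSymbol, ← hx, quadraticChar_apply]
    congr
  obtain ⟨u, v, huv⟩ := h
  refine ⟨1 + v * E * (c - 1), ⟨v * (c - 1), by ring⟩, ?_⟩
  rw [← hc]
  refine jac_congr hP ⟨-u * (c - 1), ?_⟩
  linear_combination (c - 1) * huv

theorem jac_eq_one_of_dvd_sub_one {b E : F[X]} (hE : E.Monic) (h : E ∣ b - 1) : jac b E = 1 := by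
  rw [jac_congr hE h, jac_one_left E]

theorem exists_monic_irreducible_dvd {f : F[X]} (hf : f.Monic) (h1 : f ≠ 1) :
    ∃ P : F[X], P.Monic ∧ Irreducible P ∧ P ∣ f := by
  obtain ⟨P, hm, hi, hd⟩ := Polynomial.exists_monic_irreducible_factor f (by
    rwa [hf.isUnit_iff])
  exact ⟨P, hm, hi, hd⟩

/-- `b` is a nonresidue modulo `P` and `1` modulo `D / P`. The divisibility says that multiplication
by `b` fixes multiples of `P` modulo `D`; this kills the Gauss sum at such multiples. -/
theorem exists_jac_eq_neg_one_of_sq_not_dvd (hF : ringChar F ≠ 2) {D : F[X]} (hD : D.Monic)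
    {P : F[X]} (hP : P.Monic) (hi : Irreducible P) (hPD : P ∣ D) (hs : ¬ P * P ∣ D) :
    ∃ b, D ∣ P * (b - 1) ∧ jac b D = -1 := by
  obtain ⟨E, rfl⟩ := hPD
  have hE : E.Monic := hP.of_mul_monic_left hD
  have hco : IsCoprime P E := by
    rw [hi.coprime_iff_not_dvd]
    rintro ⟨R, rfl⟩
    exact hs ⟨R, by ring⟩
  obtain ⟨b, hb, hbP⟩ := exists_jac_eq_neg_one hF hP hi hco
  refine ⟨b, mul_dvd_mul_left P hb, ?_⟩
  rw [jac_mul_right b hP hE, hbP, jac_eq_one_of_dvd_sub_one hE hb, mul_one]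

/-- Square factors `P * P` are removed by induction; the witness for the cofactor `E` still has to
be made coprime to `P`. -/
theorem exists_jac_eq_neg_one_of_not_isSquare (hF : ringChar F ≠ 2) {h : F[X]} (hh : h.Monic)
    (hs : ¬ IsSquare h) : ∃ b, jac b h = -1 := by
  induction hn : h.natDegree using Nat.strong_induction_on generalizing h with
  | _ n ih =>
    have h1 : h ≠ 1 := by rintro rfl; exact hs IsSquare.one
    obtain ⟨P, hP, hi, hPh⟩ := exists_monic_irreducible_dvd hh h1
    by_cases h2 : P * P ∣ h
    · obtain ⟨E, rfl⟩ := h2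
      have hE : E.Monic := (hP.mul hP).of_mul_monic_left hh
      have hd : E.natDegree < n := by
        rw [← hn, (hP.mul hP).natDegree_mul hE, hP.natDegree_mul hP]
        have := hi.natDegree_pos
        omega
      obtain ⟨b, hb⟩ := ih _ hd hE (fun ⟨r, hr⟩ => hs ⟨P * r, by rw [hr]; ring⟩) rfl
      by_cases hPb : IsCoprime P b
      · refine ⟨b, ?_⟩
        rw [jac_mul_right b (hP.mul hP) hE, hb, jac_mul_right b hP hP, ← sq,
          jac_sq_of_isCoprime hP hPb, one_mul]
      · by_cases hPE : P ∣ E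
        · exfalso
          have hz : jac b P = 0 := (jac_eq_zero_iff hP).2 hPb
          obtain ⟨R, rfl⟩ := hPE
          rw [jac_mul_right b hP (hP.of_mul_monic_left hE), hz, zero_mul] at hb
          norm_num at hb
        · obtain ⟨u, v, huv⟩ := (hi.coprime_iff_not_dvd.2 hPE)
          -- Chinese remainder theorem: congruent to `b` modulo `E` and to `1` modulo `P`.
          refine ⟨u * P * b + v * E, ?_⟩
          rw [jac_mul_right _ (hP.mul hP) hE, jac_mul_right _ hP hP,
            jac_congr (a := u * P * b + v * E) (a' := b) hE
              ⟨v - v * b, by linear_combination b * huv⟩,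
            jac_congr (a := u * P * b + v * E) (a' := 1) hP
              ⟨u * b - u, by linear_combination huv⟩, hb, jac_one_left P]
          norm_num
    · obtain ⟨b, -, hb⟩ := exists_jac_eq_neg_one_of_sq_not_dvd hF hh hP hi hPh h2
      exact ⟨b, hb⟩

/-! ### Finite families of polynomials and complete residue systems -/

variable (F) in
theorem finite_degree_lt (n : ℕ) : {f : F[X] | f.degree < n}.Finite := by
  have : Finite (degreeLT F n) := Finite.of_equiv _ (degreeLTEquiv F n).toEquiv.symm
  refine (Set.toFinite (degreeLT F n : Set F[X])).subset fun f hf => ?_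
  exact mem_degreeLT.2 hf

variable (F) in
/-- The polynomials of degree less than `n` over `F`. -/
def ltDegree (n : ℕ) : Finset F[X] := (finite_degree_lt F n).toFinset

theorem mem_ltDegree {n : ℕ} {f : F[X]} : f ∈ ltDegree F n ↔ f.degree < n := by
  simp [ltDegree]

variable (F) in
theorem card_ltDegree (n : ℕ) : (ltDegree F n).card = Fintype.card F ^ n := by
  have e : {f // f ∈ ltDegree F n} ≃ (Fin n → F) :=
    (Equiv.subtypeEquivRight fun f => by rw [mem_ltDegree, mem_degreeLT]).trans
      (degreeLTEquiv F n).toEquiv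
  have := Nat.card_congr e
  simpa using this

theorem sum_monicOfDegree {M : Type*} [AddCommMonoid M] (n : ℕ) (g : F[X] → M) :
    ∑ f ∈ monicOfDegree F n, g f = ∑ r ∈ ltDegree F n, g (X ^ n + r) := by
  symm
  refine Finset.sum_nbij' (fun r => X ^ n + r) (fun f => f - X ^ n) ?_ ?_ ?_ ?_ ?_
  · intro r hr
    rw [mem_ltDegree] at hr
    rw [mem_monicOfDegree]
    exact ⟨monic_X_pow_add hr, by
      rw [natDegree_add_eq_left_of_degree_lt (by simpa using hr), natDegree_X_pow]⟩
  · intro f hf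
    rw [mem_monicOfDegree] at hf
    rw [mem_ltDegree]
    have : f.degree = n := by rw [degree_eq_natDegree hf.1.ne_zero, hf.2]
    rw [← this]
    exact degree_sub_lt_left (by simp [this]) hf.1.ne_zero (by simp [hf.1.leadingCoeff])
  · intro r _; simp
  · intro r _; simp
  · intro r _; simp

variable (F) in
theorem card_monicOfDegree (n : ℕ) : (monicOfDegree F n).card = Fintype.card F ^ n := by
  rw [Finset.card_eq_sum_ones, sum_monicOfDegree, ← Finset.card_eq_sum_ones, card_ltDegree]

theorem monicOfDegree_zero : monicOfDegree F 0 = {1} := by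
  ext f
  rw [mem_monicOfDegree, Finset.mem_singleton]
  constructor
  · rintro ⟨h, h'⟩; exact h.natDegree_eq_zero.1 h'
  · rintro rfl; simp

theorem mul_mem_monicOfDegree {m n : ℕ} {a b : F[X]} (ha : a ∈ monicOfDegree F m)
    (hb : b ∈ monicOfDegree F n) : a * b ∈ monicOfDegree F (m + n) := by
  rw [mem_monicOfDegree] at *
  exact ⟨ha.1.mul hb.1, by rw [ha.1.natDegree_mul hb.1, ha.2, hb.2]⟩

theorem polyNorm_of_mem {n : ℕ} {f : F[X]} (h : f ∈ monicOfDegree F n) :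
    polyNorm f = Fintype.card F ^ n := by
  rw [polyNorm, (mem_monicOfDegree.1 h).2]

/-- Multiplication by `b` modulo `h`, with the quotient by `h` kept. -/
def twist (h b a : F[X]) : F[X] := h * (a /ₘ h) + (b * a) %ₘ h

section twist

variable {h : F[X]} (hh : h.Monic)
include hh

theorem dvd_twist_sub (b a : F[X]) : h ∣ twist h b a - b * a := by
  refine ⟨a /ₘ h - (b * a) /ₘ h, ?_⟩
  rw [twist]
  linear_combination modByMonic_add_div (b * a) h

theorem twist_divByMonic (b a : F[X]) : twist h b a /ₘ h = a /ₘ h :=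
  (div_modByMonic_unique (a /ₘ h) ((b * a) %ₘ h) hh
    ⟨by rw [twist, add_comm], degree_modByMonic_lt _ hh⟩).1

theorem modByMonic_eq_of_dvd_sub {a b : F[X]} (hd : h ∣ a - b) : a %ₘ h = b %ₘ h := by
  rw [← sub_eq_zero, ← sub_modByMonic, (modByMonic_eq_zero_iff_dvd hh).2 hd]

theorem twist_twist {b b' : F[X]} (hb : h ∣ b' * b - 1) (a : F[X]) :
    twist h b' (twist h b a) = a := by
  rw [twist, twist_divByMonic hh, modByMonic_eq_of_dvd_sub hh (b := a), add_comm,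
    modByMonic_add_div]
  obtain ⟨u, hu⟩ := hb
  obtain ⟨v, hv⟩ := dvd_twist_sub hh b a
  exact ⟨b' * v + u * a, by linear_combination b' * hv + a * hu⟩

theorem degree_twist_sub_lt (b a : F[X]) : (twist h b a - a).degree < h.degree := by
  have : twist h b a - a = (b * a) %ₘ h - a %ₘ h := by
    rw [twist]; linear_combination modByMonic_add_div a h
  rw [this]
  exact (degree_sub_le _ _).trans_lt
    (max_lt (degree_modByMonic_lt _ hh) (degree_modByMonic_lt _ hh))

/-- `S` is a union of full residue systems modulo `h`, and multiplication by the unit `b` permutes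
each of them. -/
theorem sum_twist {M : Type*} [AddCommMonoid M] {S : Finset F[X]}
    (hS : ∀ a ∈ S, ∀ r : F[X], r.degree < h.degree → a + r ∈ S) {b : F[X]} (hb : IsCoprime h b)
    (g : F[X] → M) : ∑ a ∈ S, g (twist h b a) = ∑ a ∈ S, g a := by
  obtain ⟨u, b', hu⟩ := hb
  have h1 : h ∣ b' * b - 1 := ⟨-u, by linear_combination hu⟩
  have h2 : h ∣ b * b' - 1 := by rwa [mul_comm]
  have hm : ∀ c, ∀ a ∈ S, twist h c a ∈ S := fun c a ha => by
    simpa using hS a ha _ (degree_twist_sub_lt hh c a)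
  exact Finset.sum_nbij' (twist h b) (twist h b') (hm b) (hm b')
    (fun a _ => twist_twist hh h1 a) (fun a _ => twist_twist hh h2 a) (fun a _ => rfl)

theorem add_mem_monicOfDegree {m : ℕ} (hm : h.natDegree ≤ m) :
    ∀ a ∈ monicOfDegree F m, ∀ r : F[X], r.degree < h.degree → a + r ∈ monicOfDegree F m := by
  intro a ha r hr
  rw [mem_monicOfDegree] at *
  have : r.degree < a.degree := hr.trans_le (by
    rw [degree_eq_natDegree hh.ne_zero, degree_eq_natDegree ha.1.ne_zero, ha.2]
    exact_mod_cast hm)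
  exact ⟨ha.1.add_of_left this, by rw [natDegree_add_eq_left_of_degree_lt this, ha.2]⟩

theorem add_mem_ltDegree {m : ℕ} (hm : h.natDegree ≤ m) :
    ∀ a ∈ ltDegree F m, ∀ r : F[X], r.degree < h.degree → a + r ∈ ltDegree F m := by
  intro a ha r hr
  rw [mem_ltDegree] at *
  refine (degree_add_le _ _).trans_lt (max_lt ha (hr.trans_le ?_))
  rw [degree_eq_natDegree hh.ne_zero]
  exact_mod_cast hm

theorem jac_twist (b a : F[X]) : jac (twist h b a) h = jac b h * jac a h := by
  rw [jac_congr hh (dvd_twist_sub hh b a), jac_mul_left _ _ hh]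

theorem isCoprime_of_jac_eq_neg_one {b : F[X]} (hb : jac b h = -1) : IsCoprime h b := by
  by_contra hc
  rw [(jac_eq_zero_iff hh).2 hc] at hb
  norm_num at hb

theorem sum_jac_eq_zero {b : F[X]} (hb : jac b h = -1) {m : ℕ} (hm : h.natDegree ≤ m) :
    ∑ a ∈ monicOfDegree F m, jac a h = 0 := by
  have := sum_twist hh (add_mem_monicOfDegree hh hm) (isCoprime_of_jac_eq_neg_one hh hb)
    (fun a => jac a h)
  simp only [jac_twist hh, hb, neg_one_mul, Finset.sum_neg_distrib] at this
  omega

end twist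

/-! ### The second moment over all monic polynomials -/

/-- Take `d` the monic gcd: the cofactors are coprime with square product, so each is a square. -/
theorem exists_sq_factors_of_mul_isSquare {f₁ f₂ : F[X]} (h₁ : f₁.Monic) (h₂ : f₂.Monic)
    (h : IsSquare (f₁ * f₂)) :
    ∃ d b c : F[X], d.Monic ∧ b.Monic ∧ c.Monic ∧ f₁ = d * (b * b) ∧ f₂ = d * (c * c) := by
  classical
  obtain ⟨s, hs⟩ := h
  set d := normalize (EuclideanDomain.gcd f₁ f₂) with hd
  have hg0 : EuclideanDomain.gcd f₁ f₂ ≠ 0 := fun h0 =>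
    h₁.ne_zero (EuclideanDomain.gcd_eq_zero_iff.1 h0).1
  have hdm : d.Monic := monic_normalize hg0
  have hass : Associated d (EuclideanDomain.gcd f₁ f₂) := normalize_associated _
  obtain ⟨u, hu⟩ : d ∣ f₁ := hass.dvd.trans (EuclideanDomain.gcd_dvd_left _ _)
  obtain ⟨v, hv⟩ : d ∣ f₂ := hass.dvd.trans (EuclideanDomain.gcd_dvd_right _ _)
  have hum : u.Monic := hdm.of_mul_monic_left (hu ▸ h₁)
  have hvm : v.Monic := hdm.of_mul_monic_left (hv ▸ h₂)
  have hco : IsCoprime u v := by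
    obtain ⟨w, hw⟩ := hass.symm.dvd
    have hab := EuclideanDomain.gcd_eq_gcd_ab f₁ f₂
    refine ⟨EuclideanDomain.gcdA f₁ f₂ * w, EuclideanDomain.gcdB f₁ f₂ * w, ?_⟩
    apply mul_left_cancel₀ hdm.ne_zero
    linear_combination -hw - w * hab - w * EuclideanDomain.gcdA f₁ f₂ * hu
      - w * EuclideanDomain.gcdB f₁ f₂ * hv
  have hds : d ∣ s := by
    have : d ^ 2 ∣ s ^ 2 := ⟨u * v, by rw [sq, sq, ← hs, hu, hv]; ring⟩
    exact (UniqueFactorizationMonoid.pow_dvd_pow_iff_dvd two_ne_zero).1 this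
  obtain ⟨t, rfl⟩ := hds
  have huv : u * v = t ^ 2 := by
    apply mul_left_cancel₀ (mul_ne_zero hdm.ne_zero hdm.ne_zero)
    rw [hu, hv] at hs
    linear_combination hs
  have key : ∀ {u v : F[X]}, u.Monic → IsCoprime u v → u * v = t ^ 2 →
      ∃ b : F[X], b.Monic ∧ u = b * b := by
    intro u v hum hco huv
    obtain ⟨b, hb⟩ := exists_associated_pow_of_mul_eq_pow' hco huv
    have hb0 : b ≠ 0 := by
      rintro rfl
      exact hum.ne_zero (by simpa using hb.symm)
    refine ⟨normalize b, monic_normalize hb0, ?_⟩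
    refine eq_of_monic_of_associated hum ((monic_normalize hb0).mul (monic_normalize hb0)) ?_
    rw [← sq]
    exact hb.symm.trans ((normalize_associated b).symm.pow_pow)
  obtain ⟨b, hb, rfl⟩ := key hum hco huv
  obtain ⟨c, hc, rfl⟩ := key hvm hco.symm (by rw [mul_comm, huv])
  exact ⟨d, b, c, hdm, hb, hc, hu, hv⟩

-- With `f₁ = d b²`, `f₂ = d c²` and `deg b = deg c = k`, there are `q ^ (n - 2k) * q ^ k * q ^ k =
-- q ^ n` triples for each `k`.
open Classical in
theorem card_pairs_isSquare_le (n : ℕ) :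
    ((monicOfDegree F n ×ˢ monicOfDegree F n).filter fun p => IsSquare (p.1 * p.2)).card ≤
      (n + 1) * Fintype.card F ^ n := by
  set S := (Finset.range (n + 1)).filter fun k => 2 * k ≤ n
  have hsub : ((monicOfDegree F n ×ˢ monicOfDegree F n).filter fun p => IsSquare (p.1 * p.2)) ⊆
      S.biUnion fun k => (monicOfDegree F (n - 2 * k) ×ˢ (monicOfDegree F k ×ˢ monicOfDegree F k)).image
        fun x => (x.1 * (x.2.1 * x.2.1), x.1 * (x.2.2 * x.2.2)) := by
    rintro ⟨f₁, f₂⟩ hf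
    simp only [Finset.mem_filter, Finset.mem_product, mem_monicOfDegree] at hf
    obtain ⟨⟨⟨h1, hn1⟩, h2, hn2⟩, hsq⟩ := hf
    obtain ⟨d, b, c, hd, hb, hc, rfl, rfl⟩ := exists_sq_factors_of_mul_isSquare h1 h2 hsq
    rw [hd.natDegree_mul (hb.mul hb), hb.natDegree_mul hb] at hn1
    rw [hd.natDegree_mul (hc.mul hc), hc.natDegree_mul hc] at hn2
    simp only [Finset.mem_biUnion, Finset.mem_image, Finset.mem_product, S, Finset.mem_filter,
      Finset.mem_range, mem_monicOfDegree]
    exact ⟨b.natDegree, ⟨by omega, by omega⟩, (d, b, c),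
      ⟨⟨hd, by simp only; omega⟩, ⟨hb, rfl⟩, hc, by simp only; omega⟩, rfl⟩
  refine (Finset.card_le_card hsub).trans (Finset.card_biUnion_le.trans ?_)
  calc _ ≤ ∑ k ∈ S, Fintype.card F ^ n := by
        refine Finset.sum_le_sum fun k hk => Finset.card_image_le.trans ?_
        simp only [S, Finset.mem_filter] at hk
        rw [Finset.card_product, Finset.card_product, card_monicOfDegree, card_monicOfDegree,
          ← pow_add, ← pow_add]
        exact le_of_eq (by congr 1; omega)
    _ ≤ _ := by
        rw [Finset.sum_const, smul_eq_mul]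
        refine Nat.mul_le_mul_right _ ((Finset.card_filter_le _ _).trans (by simp))

/-- Off the square pairs, `D` runs over complete residue systems modulo `f₁ f₂`, of degree `2n ≤ m`,
and the sum cancels. -/
theorem sum_sq_sum_jac_le (hF : ringChar F ≠ 2) {m n : ℕ} (h : 2 * n ≤ m) :
    ∑ D ∈ monicOfDegree F m, (∑ f ∈ monicOfDegree F n, jac D f) ^ 2 ≤
      (n + 1) * (Fintype.card F : ℤ) ^ n * (Fintype.card F : ℤ) ^ m := by
  classical
  calc _ = ∑ p ∈ monicOfDegree F n ×ˢ monicOfDegree F n,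
        ∑ D ∈ monicOfDegree F m, jac D (p.1 * p.2) := by
        rw [Finset.sum_comm]
        refine Finset.sum_congr rfl fun D _ => ?_
        rw [sq, Finset.sum_mul_sum, Finset.sum_product]
        refine Finset.sum_congr rfl fun f hf => Finset.sum_congr rfl fun f' hf' => ?_
        rw [jac_mul_right D (mem_monicOfDegree.1 hf).1 (mem_monicOfDegree.1 hf').1]
    _ ≤ ∑ p ∈ monicOfDegree F n ×ˢ monicOfDegree F n,
        if IsSquare (p.1 * p.2) then (Fintype.card F : ℤ) ^ m else 0 := by
        refine Finset.sum_le_sum fun p hp => ?_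
        rw [Finset.mem_product] at hp
        obtain ⟨hm, hd⟩ := mem_monicOfDegree.1 (mul_mem_monicOfDegree hp.1 hp.2)
        split_ifs with hs
        · calc _ ≤ ∑ D ∈ monicOfDegree F m, (1 : ℤ) :=
                Finset.sum_le_sum fun D _ => (le_abs_self _).trans (abs_jac_le_one _ _)
            _ = _ := by simp [card_monicOfDegree]
        · obtain ⟨b, hb⟩ := exists_jac_eq_neg_one_of_not_isSquare hF hm hs
          exact (sum_jac_eq_zero hm hb (by omega)).le
    _ = ((monicOfDegree F n ×ˢ monicOfDegree F n).filter
          fun p => IsSquare (p.1 * p.2)).card * (Fintype.card F : ℤ) ^ m := by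
        rw [← Finset.sum_filter, Finset.sum_const, nsmul_eq_mul]
    _ ≤ _ := by
        gcongr
        exact_mod_cast card_pairs_isSquare_le n

/-! ### Gauss sums and the functional equation -/

section GaussSum

variable {D : F[X]} (hD : D.Monic)

/-- The residue at infinity of `x / D`, up to sign. -/
def topCoeff (D x : F[X]) : F := (x %ₘ D).coeff (D.natDegree - 1)

theorem topCoeff_add (x y : F[X]) : topCoeff D (x + y) = topCoeff D x + topCoeff D y := by
  rw [topCoeff, add_modByMonic, coeff_add, topCoeff, topCoeff]

/-- The Gauss sum modulo `D` of the quadratic character, twisted by `f`. -/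
def polyGaussSum (D : F[X]) (ψ : AddChar F ℂ) (f : F[X]) : ℂ :=
  ∑ a ∈ ltDegree F D.natDegree, (jac a D : ℂ) * ψ (topCoeff D (a * f))

include hD

theorem topCoeff_congr {x y : F[X]} (h : D ∣ x - y) : topCoeff D x = topCoeff D y := by
  rw [topCoeff, modByMonic_eq_of_dvd_sub hD h, topCoeff]

theorem topCoeff_of_degree_lt {x : F[X]} (h : x.degree < D.degree) :
    topCoeff D x = x.coeff (D.natDegree - 1) := by
  rw [topCoeff, (modByMonic_eq_self_iff hD).2 h]

theorem topCoeff_mul {a f : F[X]} {n k : ℕ} (hD' : D.natDegree = n + k + 1) {j l : ℕ}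
    (hjl : j + l = n + k) (ha : a.natDegree ≤ j) (hf : f.natDegree ≤ l) :
    topCoeff D (a * f) = a.coeff j * f.coeff l := by
  have : a * f = 0 ∨ (a * f).degree < D.degree := by
    by_cases h0 : a * f = 0
    · exact Or.inl h0
    · right
      rw [degree_eq_natDegree h0, degree_eq_natDegree hD.ne_zero]
      have := natDegree_mul_le (p := a) (q := f)
      exact_mod_cast (by omega : (a * f).natDegree < D.natDegree)
  have hlt : (a * f).degree < D.degree := by
    rcases this with h | h
    · rw [h, degree_zero, bot_lt_iff_ne_bot, Ne, degree_eq_bot]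
      exact hD.ne_zero
    · exact h
  rw [topCoeff_of_degree_lt hD hlt, hD', Nat.add_sub_cancel, ← hjl,
    coeff_mul_add_eq_of_natDegree_le ha hf]

/-- For `f` coprime to `D`, substitute `f a` for `a`. Otherwise a common prime `P` gives a twist
that changes the sign of the character but not `a * f` modulo `D`, so the sum equals its negative.
-/
theorem polyGaussSum_eq (hF : ringChar F ≠ 2) (hs : Squarefree D) (ψ : AddChar F ℂ) (f : F[X]) :
    polyGaussSum D ψ f = jac f D * polyGaussSum D ψ 1 := by
  classical
  by_cases hc : IsCoprime D f
  · have h1 : polyGaussSum D ψ 1 = jac f D * polyGaussSum D ψ f := by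
      rw [polyGaussSum, ← sum_twist hD (add_mem_ltDegree hD le_rfl) hc, polyGaussSum,
        Finset.mul_sum]
      refine Finset.sum_congr rfl fun a _ => ?_
      rw [jac_twist hD, mul_one, topCoeff_congr hD (dvd_twist_sub hD f a), mul_comm f a]
      push_cast
      ring
    have h2 : (jac f D : ℂ) ^ 2 = 1 := by exact_mod_cast jac_sq_of_isCoprime hD hc
    rw [h1, ← mul_assoc, ← sq, h2, one_mul]
  · rw [(jac_eq_zero_iff hD).2 hc, Int.cast_zero, zero_mul]
    obtain ⟨P, hP, hi, hPd⟩ := Polynomial.exists_monic_irreducible_factor (EuclideanDomain.gcd D f)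
      (by rwa [EuclideanDomain.gcd_isUnit_iff])
    have hPD : P ∣ D := hPd.trans (EuclideanDomain.gcd_dvd_left _ _)
    have hPf : P ∣ f := hPd.trans (EuclideanDomain.gcd_dvd_right _ _)
    clear hPd hc
    obtain ⟨r, rfl⟩ := hPf
    obtain ⟨b, hb, hbD⟩ := exists_jac_eq_neg_one_of_sq_not_dvd hF hD hP hi hPD
      fun h => hi.not_isUnit (hs P h)
    have h1 : polyGaussSum D ψ (P * r) = -polyGaussSum D ψ (P * r) := by
      conv_lhs => rw [polyGaussSum, ← sum_twist hD (add_mem_ltDegree hD le_rfl)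
        (isCoprime_of_jac_eq_neg_one hD hbD)]
      rw [polyGaussSum, ← Finset.sum_neg_distrib]
      refine Finset.sum_congr rfl fun a _ => ?_
      have : D ∣ twist D b a * (P * r) - a * (P * r) := by
        obtain ⟨u, hu⟩ := dvd_twist_sub hD b a
        obtain ⟨v, hv⟩ := hb
        exact ⟨u * P * r + a * r * v, by linear_combination P * r * hu + a * r * hv⟩
      rw [jac_twist hD, topCoeff_congr hD this, hbD]
      push_cast
      ring
    exact self_eq_neg.1 h1

theorem sum_monic_addChar_of_mem {ψ : AddChar F ℂ} {n k : ℕ}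
    (hD' : D.natDegree = n + k + 1) {a : F[X]} (ha : a ∈ ltDegree F (k + 1)) :
    ∑ f ∈ monicOfDegree F n, ψ (topCoeff D (a * f)) = (Fintype.card F : ℂ) ^ n * ψ (a.coeff k) := by
  rw [mem_ltDegree] at ha
  have ha' : a.natDegree ≤ k := natDegree_le_iff_coeff_eq_zero.2 fun N hN =>
    (degree_lt_iff_coeff_zero _ _).1 ha N hN
  rw [Finset.sum_congr rfl (g := fun _ => ψ (a.coeff k)), Finset.sum_const, card_monicOfDegree,
    nsmul_eq_mul, Nat.cast_pow]
  intro f hf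
  rw [mem_monicOfDegree] at hf
  rw [topCoeff_mul hD hD' (add_comm k n) ha' hf.2.le, ← hf.2, coeff_natDegree, hf.1.leadingCoeff,
    mul_one]

theorem sum_monic_addChar_of_notMem {ψ : AddChar F ℂ} (hψ : ψ.IsPrimitive) {n k : ℕ}
    (hD' : D.natDegree = n + k + 1) {a : F[X]} (ha : a ∈ ltDegree F D.natDegree)
    (ha' : a ∉ ltDegree F (k + 1)) :
    ∑ f ∈ monicOfDegree F n, ψ (topCoeff D (a * f)) = 0 := by
  rw [mem_ltDegree] at ha ha'
  have ha0 : a ≠ 0 := by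
    rintro rfl
    exact ha' (by rw [degree_zero]; exact WithBot.bot_lt_coe _)
  rw [degree_eq_natDegree ha0] at ha ha'
  have h1 : a.natDegree < D.natDegree := by exact_mod_cast ha
  have h2 : k + 1 ≤ a.natDegree := by
    by_contra h
    exact ha' (by exact_mod_cast not_le.1 h)
  obtain ⟨c, hc⟩ : ∃ c, ψ c ≠ 1 := by
    have := hψ one_ne_zero
    rw [AddChar.mulShift_one, AddChar.ne_one_iff] at this
    exact this
  -- The exponent places the top term of `a * f₀` at degree `deg D - 1`; `l < n` because `deg a >
  -- k`, so adding `f₀` keeps `f` monic of degree `n`.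
  set l := n + k - a.natDegree with hl
  set f₀ : F[X] := C (c / a.leadingCoeff) * X ^ l with hf₀
  have hlead : a.leadingCoeff ≠ 0 := leadingCoeff_ne_zero.2 ha0
  have hf₀d : f₀.degree < n := (degree_C_mul_X_pow_le _ _).trans_lt (by
    exact_mod_cast (by omega : l < n))
  have htop : topCoeff D (a * f₀) = c := by
    rw [topCoeff_mul hD hD' (j := a.natDegree) (l := l) (by omega) le_rfl
      (natDegree_C_mul_X_pow_le _ _), coeff_natDegree, coeff_C_mul, coeff_X_pow]
    simp only [if_true, mul_one]
    field_simp
  have hmem : ∀ f ∈ monicOfDegree F n, ∀ r : F[X], r.degree < n → f + r ∈ monicOfDegree F n := by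
    intro f hf r hr
    exact add_mem_monicOfDegree (h := X ^ n) (monic_X_pow n) (by simp) f hf r (by simpa using hr)
  have key : ∑ f ∈ monicOfDegree F n, ψ (topCoeff D (a * (f + f₀))) =
      ∑ f ∈ monicOfDegree F n, ψ (topCoeff D (a * f)) :=
    Finset.sum_nbij' (fun f => f + f₀) (fun f => f + -f₀) (fun f hf => hmem f hf _ hf₀d)
      (fun f hf => hmem f hf _ (by rwa [degree_neg])) (fun f _ => by simp) (fun f _ => by simp)
      (fun f _ => rfl)
  simp only [mul_add, topCoeff_add, AddChar.map_add_eq_mul, htop, ← Finset.sum_mul] at key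
  have : (∑ f ∈ monicOfDegree F n, ψ (topCoeff D (a * f))) * (ψ c - 1) = 0 := by
    rw [mul_sub, key]; ring
  exact (mul_eq_zero.1 this).resolve_right (sub_ne_zero.2 hc)

theorem jac_C_mul [DecidableEq F] (hodd : Odd D.natDegree) (c : F) (a : F[X]) :
    jac (C c * a) D = quadraticChar F c * jac a D := by
  rw [jac_mul_left _ _ hD, jac_C]
  congr 1
  obtain ⟨r, hr⟩ := hodd
  rcases quadraticChar_isQuadratic F c with h | h | h <;> rw [h, hr] <;> simp [pow_succ, pow_mul]

/-- In odd degree a nonresidue constant has symbol `-1`, and scaling by it permutes the range. -/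
theorem sum_jac_ltDegree_eq_zero (hF : ringChar F ≠ 2) (hodd : Odd D.natDegree) (k : ℕ) :
    ∑ a ∈ ltDegree F k, jac a D = 0 := by
  classical
  obtain ⟨c, hc⟩ := quadraticChar_exists_neg_one hF
  have hc0 : c ≠ 0 := by
    rintro rfl
    rw [quadraticChar_zero] at hc; norm_num at hc
  have key : ∑ a ∈ ltDegree F k, jac (C c * a) D = ∑ a ∈ ltDegree F k, jac a D := by
    refine Finset.sum_nbij' (fun a => C c * a) (fun a => C c⁻¹ * a) ?_ ?_ ?_ ?_ (fun _ _ => rfl)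
    · intro a ha
      rw [mem_ltDegree] at *
      rwa [degree_C_mul hc0]
    · intro a ha
      rw [mem_ltDegree] at *
      rwa [degree_C_mul (inv_ne_zero hc0)]
    · intro a _
      rw [← mul_assoc, ← C_mul, inv_mul_cancel₀ hc0, C_1, one_mul]
    · intro a _
      rw [← mul_assoc, ← C_mul, mul_inv_cancel₀ hc0, C_1, one_mul]
  simp only [jac_C_mul hD hodd, hc, neg_one_mul, Finset.sum_neg_distrib] at key
  omega

/-- Terms with zero coefficient at `k` cancel among themselves; any other `a` is a nonzero constant
times a monic polynomial of degree `k`, and the constants assemble into the Gauss sum of `F`. -/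
theorem sum_jac_mul_addChar [DecidableEq F] (hF : ringChar F ≠ 2) (hodd : Odd D.natDegree)
    (ψ : AddChar F ℂ) (k : ℕ) :
    ∑ a ∈ ltDegree F (k + 1), (jac a D : ℂ) * ψ (a.coeff k) =
      gaussSum ((quadraticChar F).ringHomComp (Int.castRingHom ℂ)) ψ *
        ∑ f ∈ monicOfDegree F k, (jac f D : ℂ) := by
  classical
  have hlow : (ltDegree F (k + 1)).filter (fun a => a.coeff k = 0) = ltDegree F k := by
    ext a
    simp only [Finset.mem_filter, mem_ltDegree, degree_lt_iff_coeff_zero]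
    constructor
    · rintro ⟨h, h0⟩ m hm
      rcases hm.eq_or_lt with rfl | hm
      · exact h0
      · exact h m hm
    · intro h
      exact ⟨fun m hm => h m (by omega), h k le_rfl⟩
  rw [← Finset.sum_filter_add_sum_filter_not _ (fun a => a.coeff k = 0), hlow]
  have h0 : ∑ a ∈ ltDegree F k, (jac a D : ℂ) * ψ (a.coeff k) = 0 := by
    rw [← hlow, Finset.sum_congr rfl (g := fun a => ((jac a D : ℤ) : ℂ))]
    · rw [hlow]
      exact_mod_cast sum_jac_ltDegree_eq_zero hD hF hodd k
    · intro a ha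
      rw [(Finset.mem_filter.1 ha).2, AddChar.map_zero_eq_one, mul_one]
  rw [h0, zero_add, gaussSum, Finset.sum_mul_sum, ← Finset.sum_product',
    ← Finset.sum_filter_of_ne (p := fun x : F × F[X] => x.1 ≠ 0)]
  · symm
    refine Finset.sum_nbij' (fun x => C x.1 * x.2) (fun a => (a.coeff k, C (a.coeff k)⁻¹ * a))
      ?_ ?_ ?_ ?_ ?_
    · rintro ⟨c, f⟩ hx
      simp only [Finset.mem_filter, Finset.mem_product, Finset.mem_univ, true_and,
        mem_monicOfDegree] at hx
      obtain ⟨⟨hf, rfl⟩, hc⟩ := hx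
      simp only [Finset.mem_filter, mem_ltDegree, degree_C_mul hc, coeff_C_mul, coeff_natDegree,
        hf.leadingCoeff, mul_one]
      refine ⟨?_, hc⟩
      rw [degree_eq_natDegree hf.ne_zero]
      exact_mod_cast Nat.lt_succ_self _
    · intro a ha
      simp only [Finset.mem_filter, mem_ltDegree] at ha
      obtain ⟨hd, hc⟩ := ha
      have hdeg : a.natDegree = k := by
        refine le_antisymm ?_ (le_natDegree_of_ne_zero hc)
        rw [natDegree_le_iff_coeff_eq_zero]
        intro N hN
        exact (degree_lt_iff_coeff_zero _ _).1 hd N hN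
      simp only [Finset.mem_filter, Finset.mem_product, Finset.mem_univ, true_and,
        mem_monicOfDegree]
      refine ⟨⟨?_, ?_⟩, hc⟩
      · rw [Monic, leadingCoeff_mul, leadingCoeff_C, leadingCoeff, hdeg, inv_mul_cancel₀ hc]
      · rw [natDegree_C_mul (inv_ne_zero hc), hdeg]
    · rintro ⟨c, f⟩ hx
      simp only [Finset.mem_filter, Finset.mem_product, Finset.mem_univ, true_and,
        mem_monicOfDegree] at hx
      obtain ⟨⟨hf, rfl⟩, hc⟩ := hx
      simp only [coeff_C_mul, coeff_natDegree, hf.leadingCoeff, mul_one, ← mul_assoc, ← C_mul,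
        inv_mul_cancel₀ hc, C_1, one_mul]
    · intro a ha
      have hc := (Finset.mem_filter.1 ha).2
      simp only [← mul_assoc, ← C_mul, mul_inv_cancel₀ hc, C_1, one_mul]
    · rintro ⟨c, f⟩ hx
      simp only [Finset.mem_filter, Finset.mem_product, Finset.mem_univ, true_and,
        mem_monicOfDegree] at hx
      obtain ⟨⟨hf, rfl⟩, hc⟩ := hx
      simp only [coeff_C_mul, coeff_natDegree, hf.leadingCoeff, mul_one, jac_C_mul hD hodd]
      simp only [MulChar.ringHomComp_apply, eq_intCast]
      push_cast
      ring
  · rintro ⟨c, f⟩ _ h rfl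
    simp at h

/-- The sum of the Gauss sums at all monic `f` of degree `n` is evaluated in two ways: by pulling
out the symbol of `f`, and by summing over `f` first, where orthogonality leaves only `deg a ≤ k`.
-/
theorem polyGaussSum_mul_sum_jac [DecidableEq F] (hF : ringChar F ≠ 2) (hs : Squarefree D)
    (hodd : Odd D.natDegree) {ψ : AddChar F ℂ} (hψ : ψ.IsPrimitive) {n k : ℕ}
    (hD' : D.natDegree = n + k + 1) :
    polyGaussSum D ψ 1 * ∑ f ∈ monicOfDegree F n, (jac f D : ℂ) =
      (Fintype.card F : ℂ) ^ n * gaussSum ((quadraticChar F).ringHomComp (Int.castRingHom ℂ)) ψ *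
        ∑ f ∈ monicOfDegree F k, (jac f D : ℂ) := by
  classical
  calc _ = ∑ f ∈ monicOfDegree F n, polyGaussSum D ψ f := by
        rw [Finset.mul_sum]
        refine Finset.sum_congr rfl fun f _ => ?_
        rw [polyGaussSum_eq hD hF hs ψ f, mul_comm]
    _ = ∑ a ∈ ltDegree F D.natDegree, (jac a D : ℂ) *
          ∑ f ∈ monicOfDegree F n, ψ (topCoeff D (a * f)) := by
        simp only [polyGaussSum, Finset.mul_sum]
        rw [Finset.sum_comm]
    _ = ∑ a ∈ ltDegree F (k + 1), (jac a D : ℂ) *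
          ∑ f ∈ monicOfDegree F n, ψ (topCoeff D (a * f)) := by
        symm
        refine Finset.sum_subset ?_ ?_
        · intro a ha
          rw [mem_ltDegree] at *
          exact ha.trans_le (by exact_mod_cast (by omega : k + 1 ≤ D.natDegree))
        · intro a ha ha'
          rw [sum_monic_addChar_of_notMem hD hψ hD' ha ha', mul_zero]
    _ = (Fintype.card F : ℂ) ^ n * ∑ a ∈ ltDegree F (k + 1), (jac a D : ℂ) * ψ (a.coeff k) := by
        rw [Finset.mul_sum]
        refine Finset.sum_congr rfl fun a ha => ?_
        rw [sum_monic_addChar_of_mem hD hD' ha]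
        ring
    _ = _ := by rw [sum_jac_mul_addChar hD hF hodd]; ring

/-- The functional equation of `L(s, χ_D)`, up to its sign. -/
theorem abs_sum_jac_functional_equation (hF : ringChar F ≠ 2) (hs : Squarefree D) {g : ℕ}
    (hg : D.natDegree = 2 * g + 1) {n k : ℕ} (hnk : n + k = 2 * g) :
    |∑ f ∈ monicOfDegree F n, jac f D| * (Fintype.card F : ℤ) ^ g =
      (Fintype.card F : ℤ) ^ n * |∑ f ∈ monicOfDegree F k, jac f D| := by
  classical
  set A : ℕ → ℤ := fun n => ∑ f ∈ monicOfDegree F n, jac f D with hA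
  have hodd : Odd D.natDegree := ⟨g, hg⟩
  set ψ := AddChar.FiniteField.primitiveChar_to_Complex F
  have hψ : ψ.IsPrimitive := AddChar.FiniteField.primitiveChar_to_Complex_isPrimitive F
  set τ := gaussSum ((quadraticChar F).ringHomComp (Int.castRingHom ℂ)) ψ
  set G := polyGaussSum D ψ 1
  set q := Fintype.card F
  have hq0 : (q : ℂ) ≠ 0 := Nat.cast_ne_zero.2 Fintype.card_ne_zero
  have hτ : τ ≠ 0 := by
    refine gaussSum_ne_zero_of_nontrivial hq0 ?_ hψ
    intro h
    obtain ⟨c, hc⟩ := quadraticChar_exists_neg_one hF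
    have hc0 : IsUnit c := by
      rw [isUnit_iff_ne_zero]; rintro rfl
      rw [quadraticChar_zero] at hc; norm_num at hc
    have := congrArg (fun χ => χ c) h
    simp only [MulChar.ringHomComp_apply, hc, MulChar.one_apply hc0] at this
    norm_num at this
  have key : ∀ n k, n + k = 2 * g → G * A n = (q : ℂ) ^ n * τ * A k := by
    intro n k h
    simpa [hA] using polyGaussSum_mul_sum_jac hD hF hs hodd hψ (n := n) (k := k) (by omega)
  have hA0 : A 0 = 1 := by simp [hA, monicOfDegree_zero]
  -- The extreme cases give `G = τ A(2g)` and `G A(2g) = q ^ (2g) τ`. Hence `|A(2g)| = q ^ g`, and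
  -- `G` and `τ` are eliminated with only `τ ≠ 0` known.
  have h0 := key 0 (2 * g) (by omega)
  have h1 := key (2 * g) 0 (by omega)
  have h2 := key n k hnk
  rw [hA0, Int.cast_one, mul_one, pow_zero, one_mul] at h0
  rw [hA0, Int.cast_one, mul_one, h0] at h1
  have h3 : A (2 * g) ^ 2 = (q : ℤ) ^ (2 * g) := by
    have : (A (2 * g) : ℂ) ^ 2 = (q : ℂ) ^ (2 * g) := by
      apply mul_left_cancel₀ hτ
      linear_combination h1
    exact_mod_cast this
  have h4 : |A (2 * g)| = (q : ℤ) ^ g := by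
    have : A (2 * g) ^ 2 = ((q : ℤ) ^ g) ^ 2 := by rw [h3, ← pow_mul, mul_comm]
    rw [sq_eq_sq_iff_abs_eq_abs] at this
    rw [this, abs_of_nonneg (by positivity)]
  have h5 : A (2 * g) * A n = (q : ℤ) ^ n * A k := by
    have : (A (2 * g) : ℂ) * A n = (q : ℂ) ^ n * A k := by
      apply mul_left_cancel₀ hτ
      rw [h0] at h2
      linear_combination h2
    exact_mod_cast this
  have h6 := congrArg abs h5
  rw [abs_mul, abs_mul, h4, abs_of_nonneg (by positivity : (0 : ℤ) ≤ (q : ℤ) ^ n)] at h6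
  rw [mul_comm, h6]

end GaussSum

/-! ### Square-free parts and the count of square-free polynomials -/

theorem mem_squarefreeMonic {n : ℕ} {D : F[X]} :
    D ∈ squarefreeMonic F n ↔ D ∈ monicOfDegree F n ∧ Squarefree D := by
  simp [squarefreeMonic]

theorem exists_squarefree_mul_self {D : F[X]} (hD : D.Monic) :
    ∃ E s : F[X], E.Monic ∧ s.Monic ∧ Squarefree E ∧ D = E * (s * s) := by
  induction hn : D.natDegree using Nat.strong_induction_on generalizing D with
  | _ n ih =>
    by_cases hs : Squarefree D
    · exact ⟨D, 1, hD, monic_one, hs, by ring⟩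
    · rw [squarefree_iff_no_irreducibles hD.ne_zero] at hs
      push Not at hs
      obtain ⟨P, hi, hP⟩ := hs
      classical
      have hPm : (normalize P).Monic := monic_normalize hi.ne_zero
      obtain ⟨R, rfl⟩ : normalize P * normalize P ∣ D :=
        (mul_dvd_mul (normalize_associated P).dvd (normalize_associated P).dvd).trans hP
      have hR : R.Monic := (hPm.mul hPm).of_mul_monic_left hD
      have hd : R.natDegree < n := by
        rw [← hn, (hPm.mul hPm).natDegree_mul hR, hPm.natDegree_mul hPm]
        have := ((normalize_associated P).symm.irreducible hi).natDegree_pos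
        omega
      obtain ⟨E, s, hE, hs, hsq, rfl⟩ := ih _ hd hR rfl
      exact ⟨E, normalize P * s, hE, hPm.mul hs, hsq, by ring⟩

/-- After division by the gcd, a square coprime to `b` divides the square-free `E`, so its root is a
unit. -/
theorem dvd_of_mul_self_dvd {E s t : F[X]} (hE : Squarefree E) (ht : t ≠ 0)
    (h : s * s ∣ E * (t * t)) : s ∣ t := by
  classical
  set d := EuclideanDomain.gcd s t
  have hd0 : d ≠ 0 := fun h0 => ht (EuclideanDomain.gcd_eq_zero_iff.1 h0).2
  have hab : d = s * EuclideanDomain.gcdA s t + t * EuclideanDomain.gcdB s t :=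
    EuclideanDomain.gcd_eq_gcd_ab s t
  obtain ⟨a, ha⟩ : d ∣ s := EuclideanDomain.gcd_dvd_left s t
  obtain ⟨b, hb⟩ : d ∣ t := EuclideanDomain.gcd_dvd_right s t
  have hco : IsCoprime a b := by
    refine ⟨EuclideanDomain.gcdA s t, EuclideanDomain.gcdB s t, mul_left_cancel₀ hd0 ?_⟩
    linear_combination -EuclideanDomain.gcdA s t * ha - EuclideanDomain.gcdB s t * hb - hab
  have h1 : a * a ∣ E * (b * b) := by
    rw [ha, hb] at h
    apply (mul_dvd_mul_iff_left (mul_ne_zero hd0 hd0)).1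
    convert h using 1 <;> ring
  have h2 : a * a ∣ E := (hco.mul_left hco |>.mul_right (hco.mul_left hco)).dvd_of_dvd_mul_right h1
  rw [ha, hb]
  exact mul_dvd_mul_left d (hE a h2).dvd

theorem squarefree_mul_self_unique {E E' s s' : F[X]} (hs : s.Monic)
    (hs' : s'.Monic) (hE : Squarefree E) (hE' : Squarefree E')
    (h : E * (s * s) = E' * (s' * s')) : E = E' ∧ s = s' := by
  have h1 : s = s' := eq_of_monic_of_associated hs hs' (associated_of_dvd_dvd
    (dvd_of_mul_self_dvd hE' hs'.ne_zero ⟨E, by rw [← h]; ring⟩)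
    (dvd_of_mul_self_dvd hE hs.ne_zero ⟨E', by rw [h]; ring⟩))
  subst h1
  exact ⟨mul_right_cancel₀ (mul_ne_zero hs.ne_zero hs.ne_zero) h, rfl⟩

theorem sum_monicOfDegree_eq_sum_squarefree {M : Type*} [AddCommMonoid M] (m : ℕ) (w : F[X] → M) :
    ∑ D ∈ monicOfDegree F m, w D = ∑ k ∈ Finset.range (m / 2 + 1),
      ∑ s ∈ monicOfDegree F k, ∑ E ∈ squarefreeMonic F (m - 2 * k), w (E * (s * s)) := by
  simp only [← Finset.sum_product']
  rw [Finset.sum_sigma']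
  symm
  refine Finset.sum_bij (fun x _ => x.2.2 * (x.2.1 * x.2.1)) ?_ ?_ ?_ (fun _ _ => rfl)
  · rintro ⟨k, s, E⟩ hx
    simp only [Finset.mem_sigma, Finset.mem_range, Finset.mem_product, mem_squarefreeMonic] at hx
    have := mul_mem_monicOfDegree hx.2.2.1 (mul_mem_monicOfDegree hx.2.1 hx.2.1)
    convert this using 2
    omega
  · rintro ⟨k, s, E⟩ hx ⟨k', s', E'⟩ hx' h
    simp only [Finset.mem_sigma, Finset.mem_range, Finset.mem_product, mem_squarefreeMonic,
      mem_monicOfDegree] at hx hx'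
    obtain ⟨h1, h2⟩ := squarefree_mul_self_unique hx.2.1.1 hx'.2.1.1 hx.2.2.2 hx'.2.2.2 h
    obtain rfl : k = k' := by rw [← hx.2.1.2, ← hx'.2.1.2]; exact congrArg natDegree h2
    rw [h1, h2]
  · intro D hD
    rw [mem_monicOfDegree] at hD
    obtain ⟨E, s, hE, hs, hsq, rfl⟩ := exists_squarefree_mul_self hD.1
    rw [hE.natDegree_mul (hs.mul hs), hs.natDegree_mul hs] at hD
    refine ⟨⟨s.natDegree, s, E⟩, ?_, rfl⟩
    simp only [Finset.mem_sigma, Finset.mem_range, Finset.mem_product, mem_squarefreeMonic,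
      mem_monicOfDegree, hE, hs, hsq, true_and, and_true]
    omega

/-- Count monic polynomials by their square part. In degree `m + 2` the terms with nonconstant
square part are `q` times the whole count in degree `m`. -/
theorem card_squarefreeMonic_add_two (m : ℕ) :
    (squarefreeMonic F (m + 2)).card + Fintype.card F ^ (m + 1) = Fintype.card F ^ (m + 2) := by
  have h : ∀ m, Fintype.card F ^ m = ∑ k ∈ Finset.range (m / 2 + 1),
      Fintype.card F ^ k * (squarefreeMonic F (m - 2 * k)).card := by
    intro m
    have := sum_monicOfDegree_eq_sum_squarefree (F := F) m (fun _ => 1)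
    simpa [card_monicOfDegree] using this
  have h2 := h (m + 2)
  rw [show (m + 2) / 2 + 1 = (m / 2 + 1) + 1 by omega, Finset.sum_range_succ'] at h2
  rw [h2, pow_succ, h m, Finset.sum_mul, add_comm]
  congr 1
  · refine Finset.sum_congr rfl fun k _ => ?_
    rw [show m + 2 - 2 * (k + 1) = m - 2 * k by omega]
    ring
  · simp

theorem card_squarefreeMonic_le (m : ℕ) :
    (squarefreeMonic F m).card ≤ Fintype.card F ^ m := by
  rw [← card_monicOfDegree]
  exact Finset.card_le_card fun D hD => (mem_squarefreeMonic.1 hD).1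

theorem pow_le_two_mul_card_squarefreeMonic (m : ℕ) :
    Fintype.card F ^ m ≤ 2 * (squarefreeMonic F m).card := by
  have hq : 2 ≤ Fintype.card F := Fintype.one_lt_card
  match m with
  | 0 =>
    have : (1 : F[X]) ∈ squarefreeMonic F 0 := by
      rw [mem_squarefreeMonic, monicOfDegree_zero]; simp
    have := Finset.card_pos.2 ⟨_, this⟩
    simp only [pow_zero]; omega
  | 1 =>
    have : squarefreeMonic F 1 = monicOfDegree F 1 := by
      ext D
      rw [mem_squarefreeMonic, and_iff_left_iff_imp, mem_monicOfDegree]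
      intro h
      refine (irreducible_of_degree_eq_one ?_).squarefree
      rw [degree_eq_natDegree h.1.ne_zero, h.2]; rfl
    rw [this, card_monicOfDegree]; omega
  | m + 2 =>
    have := card_squarefreeMonic_add_two (F := F) m
    have h2 : Fintype.card F ^ (m + 2) = Fintype.card F * Fintype.card F ^ (m + 1) := by ring
    have h3 := Nat.mul_le_mul_right (Fintype.card F ^ (m + 1)) hq
    omega

theorem card_squarefreeMonic_pos (m : ℕ) : 0 < (squarefreeMonic F m).card := by
  have := pow_le_two_mul_card_squarefreeMonic (F := F) m
  have : 0 < Fintype.card F ^ m := pow_pos Fintype.card_pos m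
  omega

theorem tendsto_card_squarefreeMonic :
    Filter.Tendsto (fun m => ((squarefreeMonic F m).card : ℝ) / (Fintype.card F : ℝ) ^ m)
      Filter.atTop (nhds (1 - 1 / (Fintype.card F : ℝ))) := by
  refine tendsto_const_nhds.congr' ?_
  filter_upwards [Filter.eventually_ge_atTop 2] with m hm
  obtain ⟨m, rfl⟩ := Nat.exists_eq_add_of_le' hm
  have hq : (Fintype.card F : ℝ) ≠ 0 := Nat.cast_ne_zero.2 Fintype.card_ne_zero
  have : ((squarefreeMonic F (m + 2)).card : ℝ) + (Fintype.card F : ℝ) ^ (m + 1)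
      = (Fintype.card F : ℝ) ^ (m + 2) := by exact_mod_cast card_squarefreeMonic_add_two (F := F) m
  rw [eq_div_iff (pow_ne_zero _ hq), eq_sub_of_add_eq this]
  field_simp
  ring

/-! ### Cancellation over square-free polynomials for non-square moduli -/

/-- The rate `√(2q)` is chosen so that going down by `2(k + 1)` gains `(2q) ^ (k + 1)` against `|e
(k + 1)| ≤ q ^ (k + 1)`, leaving a geometric series of ratio `1/2` with sum at most `1`. It is below
`q` once `q > 2`. -/
theorem abs_le_pow_sqrt_of_recursion {q : ℝ} (hq : 1 ≤ q) {N : ℕ} {S e : ℕ → ℝ}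
    (hS : ∀ m, |S m| ≤ q ^ m) (he : ∀ k, |e k| ≤ q ^ k)
    (h : ∀ m, N ≤ m → S m = -∑ k ∈ Finset.range (m / 2), e (k + 1) * S (m - 2 * (k + 1))) (m : ℕ) :
    |S m| ≤ q ^ N * √(2 * q) ^ m := by
  set r := √(2 * q) with hr
  have hr2 : r ^ 2 = 2 * q := Real.sq_sqrt (by linarith)
  have hr1 : 1 ≤ r := Real.one_le_sqrt.2 (by linarith)
  induction m using Nat.strong_induction_on with
  | _ m ih =>
    by_cases hm : N ≤ m
    · rw [h m hm, abs_neg]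
      calc _ ≤ ∑ k ∈ Finset.range (m / 2), q ^ N * r ^ m * (1 / 2) ^ (k + 1) := by
            refine (Finset.abs_sum_le_sum_abs _ _).trans (Finset.sum_le_sum fun k hk => ?_)
            rw [Finset.mem_range] at hk
            rw [abs_mul]
            calc _ ≤ q ^ (k + 1) * (q ^ N * r ^ (m - 2 * (k + 1))) :=
                  mul_le_mul (he _) (ih _ (by omega)) (abs_nonneg _) (by positivity)
              _ = _ := by
                  have : r ^ m = r ^ (m - 2 * (k + 1)) * (2 * q) ^ (k + 1) := by
                    rw [← hr2, ← pow_mul, ← pow_add]; congr 1; omega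
                  rw [this, mul_pow, div_pow, one_pow]
                  field_simp
        _ = q ^ N * r ^ m * ∑ k ∈ Finset.range (m / 2), (1 / 2 : ℝ) ^ (k + 1) := by
            rw [Finset.mul_sum]
        _ ≤ q ^ N * r ^ m * 1 := by
            refine mul_le_mul_of_nonneg_left ?_ (by positivity)
            simp only [pow_succ, ← Finset.sum_mul]
            have := sum_geometric_two_le (m / 2)
            linarith
        _ = _ := mul_one _
    · calc _ ≤ q ^ m := hS m
        _ ≤ q ^ N := pow_le_pow_right₀ hq (by omega)
        _ ≤ _ := le_mul_of_one_le_right (by positivity) (one_le_pow₀ hr1)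

/-- For `m ≥ deg f` the sum over all monic `D` vanishes; writing `D = E s²` and isolating `s = 1`
gives the recursion. -/
theorem abs_sum_squarefree_jac_le (hF : ringChar F ≠ 2) {f : F[X]} (hf : f.Monic)
    (hsq : ¬ IsSquare f) (m : ℕ) :
    |((∑ D ∈ squarefreeMonic F m, jac D f : ℤ) : ℝ)| ≤
      (Fintype.card F : ℝ) ^ f.natDegree * √(2 * Fintype.card F) ^ m := by
  refine abs_le_pow_sqrt_of_recursion
    (S := fun m => ((∑ D ∈ squarefreeMonic F m, jac D f : ℤ) : ℝ))
    (e := fun k => ((∑ s ∈ monicOfDegree F k, jac s f ^ 2 : ℤ) : ℝ))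
    (Nat.one_le_cast.2 Fintype.card_pos) (fun m => ?_) (fun k => ?_) (fun m hm => ?_) m
  · have : |∑ D ∈ squarefreeMonic F m, jac D f| ≤ (Fintype.card F : ℤ) ^ m := by
      refine (Finset.abs_sum_le_sum_abs _ _).trans ?_
      calc _ ≤ ∑ D ∈ squarefreeMonic F m, (1 : ℤ) :=
            Finset.sum_le_sum fun D _ => abs_jac_le_one _ _
        _ ≤ _ := by simpa using (by exact_mod_cast card_squarefreeMonic_le m)
    rw [← Int.cast_abs]
    exact_mod_cast this
  · have : |∑ s ∈ monicOfDegree F k, jac s f ^ 2| ≤ (Fintype.card F : ℤ) ^ k := by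
      refine (Finset.abs_sum_le_sum_abs _ _).trans ?_
      calc _ ≤ ∑ s ∈ monicOfDegree F k, (1 : ℤ) := Finset.sum_le_sum fun s _ => by
            rw [abs_pow]
            exact pow_le_one₀ (abs_nonneg _) (abs_jac_le_one _ _)
        _ = _ := by simp [card_monicOfDegree]
    rw [← Int.cast_abs]
    exact_mod_cast this
  · obtain ⟨b, hb⟩ := exists_jac_eq_neg_one_of_not_isSquare hF hf hsq
    have h0 := sum_jac_eq_zero hf hb hm
    rw [sum_monicOfDegree_eq_sum_squarefree, Finset.sum_range_succ'] at h0
    have h1 : ∀ k, ∑ s ∈ monicOfDegree F k, ∑ E ∈ squarefreeMonic F (m - 2 * k),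
        jac (E * (s * s)) f = (∑ s ∈ monicOfDegree F k, jac s f ^ 2) *
          ∑ E ∈ squarefreeMonic F (m - 2 * k), jac E f := by
      intro k
      rw [Finset.sum_mul_sum]
      refine Finset.sum_congr rfl fun s _ => Finset.sum_congr rfl fun E _ => ?_
      rw [jac_mul_left _ _ hf, jac_mul_left _ _ hf]
      ring
    rw [h1 0, Finset.sum_congr rfl fun k _ => h1 (k + 1)] at h0
    simp only [monicOfDegree_zero, Finset.sum_singleton, jac_one_left, one_pow, one_mul,
      mul_zero, Nat.sub_zero] at h0
    exact_mod_cast eq_neg_of_add_eq_zero_right h0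

theorem tendsto_sum_squarefree_jac_of_not_isSquare (hF : ringChar F ≠ 2) {f : F[X]} (hf : f.Monic)
    (hsq : ¬ IsSquare f) :
    Filter.Tendsto (fun m => ((∑ D ∈ squarefreeMonic F m, jac D f : ℤ) : ℝ) /
      (Fintype.card F : ℝ) ^ m) Filter.atTop (nhds 0) := by
  set q : ℝ := (Fintype.card F : ℝ) with hqdef
  have hq : 2 < q := by
    have h1 : 1 < Fintype.card F := Fintype.one_lt_card
    have h2 := FiniteField.odd_card_of_char_ne_two hF
    rw [hqdef]
    exact_mod_cast (by omega : 2 < Fintype.card F)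
  have hlt : √(2 * q) / q < 1 := by
    rw [div_lt_one (by linarith), Real.sqrt_lt' (by linarith)]
    nlinarith
  have hlim : Filter.Tendsto (fun m => q ^ f.natDegree * (√(2 * q) / q) ^ m) Filter.atTop
      (nhds 0) := by
    simpa using (tendsto_pow_atTop_nhds_zero_of_lt_one (by positivity) hlt).const_mul
      (q ^ f.natDegree)
  refine squeeze_zero_norm (fun m => ?_) hlim
  rw [Real.norm_eq_abs, abs_div, abs_of_pos (by positivity : 0 < q ^ m), div_pow, ← mul_div_assoc]
  gcongr
  exact abs_sum_squarefree_jac_le hF hf hsq m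

/-! ### Density of square-free polynomials coprime to given primes -/

theorem tendsto_zero_of_le_add_mul_shift {u ε : ℕ → ℝ} {r B : ℝ} {d : ℕ} (hr0 : 0 ≤ r) (hr : r < 1)
    (hB : ∀ m, u m ≤ B) (hu : ∀ m, 0 ≤ u m) (hε : Filter.Tendsto ε Filter.atTop (nhds 0))
    (h : ∀ m, d ≤ m → u m ≤ ε m + r * u (m - d)) : Filter.Tendsto u Filter.atTop (nhds 0) := by
  rw [Metric.tendsto_atTop]
  intro η hη
  have hr1 : 0 < 1 - r := by linarith
  -- The threshold makes `η / 2` a fixed point: `η / 2 * (1 - r) + r * (η / 2) = η / 2`.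
  obtain ⟨M, hM⟩ := Metric.tendsto_atTop.1 hε (η / 2 * (1 - r)) (by positivity)
  have hstep : ∀ j m, M + j * d ≤ m → u m ≤ r ^ j * B + η / 2 := by
    intro j
    induction j with
    | zero => intro m _; linarith [hB m]
    | succ j ih =>
      intro m hm
      have hm' : M + j * d + d ≤ m := by rw [add_assoc, ← Nat.succ_mul]; exact hm
      have h1 := h m (by omega)
      have h2 := ih (m - d) (by omega)
      have h3 := hM m (by have := Nat.zero_le (j * d); omega)
      rw [Real.dist_eq, sub_zero] at h3
      have h4 := (le_abs_self _).trans_lt h3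
      have h5 := mul_le_mul_of_nonneg_left h2 hr0
      rw [pow_succ]
      nlinarith
  obtain ⟨j, hj⟩ : ∃ j : ℕ, r ^ j * B < η / 2 := by
    have := (tendsto_pow_atTop_nhds_zero_of_lt_one hr0 hr).mul_const B
    rw [zero_mul] at this
    exact (this.eventually (gt_mem_nhds (by positivity))).exists
  refine ⟨M + j * d, fun m hm => ?_⟩
  rw [Real.dist_eq, sub_zero, abs_of_nonneg (hu m)]
  linarith [hstep j m hm]

open Classical in
/-- The number of squarefree monic polynomials of degree `m` not divisible by any element of `T`. -/
def coprimeCount (T : Finset F[X]) (m : ℕ) : ℕ :=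
  ((squarefreeMonic F m).filter fun D => ∀ P ∈ T, ¬ P ∣ D).card

theorem coprimeCount_le (T : Finset F[X]) (m : ℕ) : coprimeCount T m ≤ Fintype.card F ^ m := by
  classical
  exact (Finset.card_filter_le _ _).trans (card_squarefreeMonic_le m)

theorem monic_irreducible_dvd_iff_eq {P Q : F[X]} (hP : P.Monic) (hQ : Q.Monic)
    (hPi : Irreducible P) (hQi : Irreducible Q) : P ∣ Q ↔ P = Q := by
  constructor
  · intro h
    exact eq_of_monic_of_associated hP hQ (hPi.associated_of_dvd hQi h)
  · rintro rfl; exact dvd_rfl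

/-- Polynomials divisible by `P` are `P * R`, and square-freeness forces `P ∤ R`. -/
theorem coprimeCount_insert [DecidableEq F[X]] {T : Finset F[X]}
    (hT : ∀ P ∈ T, P.Monic ∧ Irreducible P) {P : F[X]}
    (hP : P.Monic) (hi : Irreducible P) (hPT : P ∉ T) {m : ℕ} (hm : P.natDegree ≤ m) :
    coprimeCount T m = coprimeCount (insert P T) m + coprimeCount (insert P T) (m - P.natDegree) := by
  classical
  simp only [coprimeCount]
  rw [← Finset.card_filter_add_card_filter_not (fun D => ¬ P ∣ D), Finset.filter_filter,
    Finset.filter_filter]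
  congr 1
  · congr 1
    refine Finset.filter_congr fun D _ => ?_
    rw [Finset.forall_mem_insert, and_comm]
  · symm
    refine Finset.card_bij (fun D _ => P * D) ?_ ?_ ?_
    · intro D hD
      simp only [Finset.mem_filter, mem_squarefreeMonic, Finset.forall_mem_insert] at hD ⊢
      obtain ⟨⟨hDm, hDs⟩, hPD, hTD⟩ := hD
      refine ⟨⟨?_, ?_⟩, ?_, ?_⟩
      · have := mul_mem_monicOfDegree (mem_monicOfDegree.2 ⟨hP, rfl⟩) hDm
        rwa [Nat.add_sub_cancel' hm] at this
      · rw [squarefree_mul_iff]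
        exact ⟨(hi.coprime_iff_not_dvd.2 hPD).isRelPrime, hi.squarefree, hDs⟩
      · intro Q hQ hd
        rcases (hT Q hQ).2.prime.dvd_or_dvd hd with h | h
        · rw [monic_irreducible_dvd_iff_eq (hT Q hQ).1 hP (hT Q hQ).2 hi] at h
          exact hPT (h ▸ hQ)
        · exact hTD Q hQ h
      · simp
    · intro D _ D' _ h
      exact mul_left_cancel₀ hi.ne_zero h
    · intro D hD
      simp only [Finset.mem_filter, mem_squarefreeMonic, not_not] at hD
      obtain ⟨⟨hDm, hDs⟩, hTD, R, rfl⟩ := hD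
      rw [mem_monicOfDegree] at hDm
      have hR : R.Monic := hP.of_mul_monic_left hDm.1
      refine ⟨R, ?_, rfl⟩
      simp only [Finset.mem_filter, mem_squarefreeMonic, Finset.forall_mem_insert,
        mem_monicOfDegree]
      refine ⟨⟨⟨hR, ?_⟩, hDs.of_mul_right⟩, ?_, fun Q hQ h => hTD Q hQ (h.mul_left P)⟩
      · have := hDm.2
        rw [hP.natDegree_mul hR] at this
        omega
      · rintro ⟨R', rfl⟩
        exact hi.not_isUnit (hDs P ⟨R', by ring⟩)

theorem polyNorm_pos (f : F[X]) : 0 < polyNorm f := pow_pos Fintype.card_pos _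

theorem tendsto_coprimeCount (T : Finset F[X]) (hT : ∀ P ∈ T, P.Monic ∧ Irreducible P) :
    Filter.Tendsto (fun m => (coprimeCount T m : ℝ) / (Fintype.card F : ℝ) ^ m) Filter.atTop
      (nhds ((1 - 1 / (Fintype.card F : ℝ)) *
        ∏ P ∈ T, ((polyNorm P : ℝ) / ((polyNorm P : ℝ) + 1)))) := by
  classical
  induction T using Finset.induction with
  | empty =>
    simpa [coprimeCount] using tendsto_card_squarefreeMonic (F := F)
  | insert P T hPT ih =>
    have hT' : ∀ P ∈ T, P.Monic ∧ Irreducible P := fun Q hQ => hT Q (Finset.mem_insert_of_mem hQ)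
    obtain ⟨hP, hi⟩ := hT P (Finset.mem_insert_self _ _)
    have ih := ih hT'
    rw [Finset.prod_insert hPT]
    set L := (1 - 1 / (Fintype.card F : ℝ)) *
        ∏ P ∈ T, ((polyNorm P : ℝ) / ((polyNorm P : ℝ) + 1))
    set N : ℝ := (polyNorm P : ℝ) with hN
    have hN1 : 1 < N := by
      rw [hN]
      exact_mod_cast Nat.one_lt_pow hi.natDegree_pos.ne' Fintype.one_lt_card
    set x : ℕ → ℝ := fun m => (coprimeCount T m : ℝ) / (Fintype.card F : ℝ) ^ m
    set y : ℕ → ℝ := fun m => (coprimeCount (insert P T) m : ℝ) / (Fintype.card F : ℝ) ^ m with hy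
    have hq : 0 < (Fintype.card F : ℝ) := Nat.cast_pos.2 Fintype.card_pos
    have hy0 : ∀ m, 0 ≤ y m := fun m => by positivity
    have hy1 : ∀ m, y m ≤ 1 := fun m => by
      rw [hy]; beta_reduce
      rw [div_le_one (by positivity)]
      exact_mod_cast coprimeCount_le _ m
    have hrec : ∀ m, P.natDegree ≤ m → x m = y m + 1 / N * y (m - P.natDegree) := by
      intro m hm
      have h1 : (coprimeCount T m : ℝ) = coprimeCount (insert P T) m +
        coprimeCount (insert P T) (m - P.natDegree) := by
          exact_mod_cast coprimeCount_insert hT' hP hi hPT hm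
      have h2 : (Fintype.card F : ℝ) ^ m = N * (Fintype.card F : ℝ) ^ (m - P.natDegree) := by
        rw [hN, polyNorm, Nat.cast_pow, ← pow_add, Nat.add_sub_cancel' hm]
      simp only [x, y]
      rw [h1, add_div]
      congr 1
      rw [h2]
      field_simp
    have hgoal : (1 - 1 / (Fintype.card F : ℝ)) * (N / (N + 1) *
        ∏ P ∈ T, ((polyNorm P : ℝ) / ((polyNorm P : ℝ) + 1))) = L * (N / (N + 1)) := by
      simp only [L]; ring
    rw [hgoal]
    set c := L * (N / (N + 1)) with hc
    -- A limit `c` must satisfy `L = c + c / N`, by the recursion `hrec`; since `1 / N < 1` the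
    -- deviation from `c` contracts.
    have hcL : L = c + 1 / N * c := by rw [hc]; field_simp
    rw [tendsto_iff_dist_tendsto_zero]
    have hx := tendsto_iff_dist_tendsto_zero.1 ih
    refine tendsto_zero_of_le_add_mul_shift (r := 1 / N) (B := 1 + |c|) (d := P.natDegree)
      (by positivity) (by rw [div_lt_one] <;> linarith) ?_ (fun m => dist_nonneg) hx ?_
    · intro m
      rw [Real.dist_eq]
      refine (abs_sub _ _).trans ?_
      rw [abs_of_nonneg (hy0 m)]
      linarith [hy1 m]
    · intro m hm
      simp only [Real.dist_eq]
      have h3 : y m - c = (x m - L) - 1 / N * (y (m - P.natDegree) - c) := by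
        rw [hrec m hm, hcL]; ring
      change |y m - c| ≤ |x m - L| + 1 / N * |y (m - P.natDegree) - c|
      rw [h3]
      refine (abs_sub _ _).trans ?_
      rw [abs_mul, abs_of_pos (by positivity : 0 < 1 / N)]

/-! ### Sums over monic polynomials and the Euler product -/

variable (F) in
/-- The monic polynomials, sorted by degree. -/
def sigmaMonicEquiv : (Σ n, {f : F[X] // f ∈ monicOfDegree F n}) ≃ {f : F[X] // f.Monic} where
  toFun x := ⟨x.2.1, (mem_monicOfDegree.1 x.2.2).1⟩
  invFun f := ⟨f.1.natDegree, f.1, mem_monicOfDegree.2 ⟨f.2, rfl⟩⟩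
  left_inv := by
    rintro ⟨n, f, hf⟩
    obtain ⟨h, rfl⟩ := mem_monicOfDegree.1 hf
    rfl
  right_inv _ := rfl

theorem summable_monic_iff {φ : F[X] → ℝ} (h0 : ∀ f, 0 ≤ φ f) :
    Summable (fun f : {f : F[X] // f.Monic} => φ f.1) ↔
      Summable fun n => ∑ f ∈ monicOfDegree F n, φ f := by
  rw [← (sigmaMonicEquiv F).summable_iff]
  change Summable (fun x : Σ n, {f : F[X] // f ∈ monicOfDegree F n} => φ x.2.1) ↔ _
  rw [summable_sigma_of_nonneg fun _ => h0 _]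
  constructor
  · rintro ⟨-, h⟩
    refine h.congr fun n => ?_
    rw [tsum_fintype]
    exact Finset.sum_coe_sort (monicOfDegree F n) φ
  · intro h
    refine ⟨fun n => (hasSum_fintype _).summable, h.congr fun n => ?_⟩
    rw [tsum_fintype]
    exact (Finset.sum_coe_sort _ φ).symm

theorem tsum_monic_eq {φ : F[X] → ℝ} (h : Summable (fun f : {f : F[X] // f.Monic} => φ f.1)) :
    ∑' f : {f : F[X] // f.Monic}, φ f.1 = ∑' n, ∑ f ∈ monicOfDegree F n, φ f := by
  rw [← (sigmaMonicEquiv F).tsum_eq]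
  have h' : Summable fun x => φ (sigmaMonicEquiv F x).1 := (sigmaMonicEquiv F).summable_iff.2 h
  rw [h'.tsum_sigma' fun n => (hasSum_fintype _).summable]
  refine tsum_congr fun n => ?_
  rw [tsum_fintype]
  exact Finset.sum_coe_sort _ φ

theorem polyNorm_mul {f g : F[X]} (hf : f.Monic) (hg : g.Monic) :
    polyNorm (f * g) = polyNorm f * polyNorm g := by
  rw [polyNorm, hf.natDegree_mul hg, pow_add, polyNorm, polyNorm]

theorem summable_one_div_polyNorm_sq :
    Summable fun f : {f : F[X] // f.Monic} => 1 / (polyNorm f.1 : ℝ) ^ 2 := by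
  rw [summable_monic_iff (φ := fun f => 1 / (polyNorm f : ℝ) ^ 2) fun f => by positivity]
  have hq : 1 < (Fintype.card F : ℝ) := by exact_mod_cast Fintype.one_lt_card
  refine (summable_geometric_of_lt_one (r := 1 / (Fintype.card F : ℝ)) (by positivity)
    (by rw [div_lt_one] <;> linarith)).congr fun n => ?_
  rw [Finset.sum_congr rfl (g := fun _ => 1 / ((Fintype.card F : ℝ) ^ n) ^ 2)]
  · rw [Finset.sum_const, card_monicOfDegree, nsmul_eq_mul, Nat.cast_pow, div_pow, one_pow]
    field_simp
  · intro f hf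
    rw [polyNorm_of_mem hf, Nat.cast_pow]

variable (F) in
/-- The monic irreducible polynomials. -/
abbrev MonicIrreducible : Type _ := {P : F[X] // P.Monic ∧ Irreducible P}

theorem finite_monicIrreducible_dvd {f : F[X]} (hf : f ≠ 0) :
    {P : MonicIrreducible F | P.1 ∣ f}.Finite := by
  refine Set.Finite.of_finite_image ?_ Subtype.val_injective.injOn
  refine (finite_degree_lt F (f.natDegree + 1)).subset ?_
  rintro _ ⟨P, hP, rfl⟩
  refine (degree_le_of_dvd hP hf).trans_lt ?_
  rw [degree_eq_natDegree hf]
  exact_mod_cast Nat.lt_succ_self _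

open Classical in
/-- The monic irreducible factors of `f`, without multiplicity (none if `f = 0`). -/
def primeDivisors (f : F[X]) : Finset (MonicIrreducible F) :=
  if hf : f = 0 then ∅ else (finite_monicIrreducible_dvd hf).toFinset

theorem mem_primeDivisors {f : F[X]} (hf : f ≠ 0) {P : MonicIrreducible F} :
    P ∈ primeDivisors f ↔ P.1 ∣ f := by
  simp [primeDivisors, hf]

/-- The limiting probability for a squarefree polynomial to be coprime to `f`. -/
def coprimeDensity (f : F[X]) : ℝ :=
  ∏ P ∈ primeDivisors f, ((polyNorm P.1 : ℝ) / ((polyNorm P.1 : ℝ) + 1))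

theorem coprimeDensity_nonneg (f : F[X]) : 0 ≤ coprimeDensity f :=
  Finset.prod_nonneg fun _ _ => by positivity

theorem coprimeDensity_le_one (f : F[X]) : coprimeDensity f ≤ 1 :=
  Finset.prod_le_one (fun _ _ => by positivity) fun P _ => by
    rw [div_le_one (by positivity)]; linarith

theorem coprimeDensity_one : coprimeDensity (1 : F[X]) = 1 := by
  rw [coprimeDensity, Finset.prod_eq_one]
  intro P hP
  rw [mem_primeDivisors one_ne_zero] at hP
  exact (P.2.2.not_isUnit (isUnit_of_dvd_one hP)).elim

theorem primeDivisors_mul_self (f : F[X]) : primeDivisors (f * f) = primeDivisors f := by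
  by_cases hf : f = 0
  · rw [hf, mul_zero]
  · ext P
    rw [mem_primeDivisors (mul_ne_zero hf hf), mem_primeDivisors hf]
    exact ⟨fun h => (P.2.2.prime.dvd_or_dvd h).elim id id, fun h => h.mul_left f⟩

theorem monic_prod_monicIrreducible (T : Finset (MonicIrreducible F)) :
    (∏ P ∈ T, P.1).Monic := monic_prod_of_monic _ _ fun P _ => P.2.1

theorem polyNorm_prod (T : Finset (MonicIrreducible F)) :
    polyNorm (∏ P ∈ T, P.1) = ∏ P ∈ T, polyNorm P.1 := by
  rw [polyNorm, natDegree_prod_of_monic _ _ fun P _ => P.2.1, ← Finset.prod_pow_eq_pow_sum]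
  rfl

theorem isCoprime_of_ne {P Q : MonicIrreducible F} (h : P ≠ Q) : IsCoprime P.1 Q.1 := by
  rw [P.2.2.coprime_iff_not_dvd, monic_irreducible_dvd_iff_eq P.2.1 Q.2.1 P.2.2 Q.2.2]
  exact fun h' => h (Subtype.ext h')

theorem prod_dvd_iff_subset_primeDivisors {f : F[X]} (hf : f ≠ 0)
    (T : Finset (MonicIrreducible F)) : ∏ P ∈ T, P.1 ∣ f ↔ T ⊆ primeDivisors f := by
  constructor
  · intro h P hP
    exact (mem_primeDivisors hf).2 ((Finset.dvd_prod_of_mem _ hP).trans h)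
  · intro h
    exact Finset.prod_dvd_of_coprime (fun P _ Q _ hPQ => isCoprime_of_ne hPQ)
      fun P hP => (mem_primeDivisors hf).1 (h hP)

theorem sigma_divisorSet_ext
    {x y : Σ f : {f : F[X] // f.Monic}, {T // T ∈ (primeDivisors f.1).powerset}}
    (h : x.1.1 = y.1.1) (h' : x.2.1 = y.2.1) : x = y := by
  obtain ⟨⟨f, hf⟩, T, hT⟩ := x
  obtain ⟨⟨f', hf'⟩, T', hT'⟩ := y
  simp only at h h'
  subst h h'
  rfl

variable (F) in
/-- A monic polynomial with a set of irreducible factors, as that set and the complementary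
factor. -/
def divisorSetEquiv :
    (Σ f : {f : F[X] // f.Monic}, {T // T ∈ (primeDivisors f.1).powerset}) ≃
      Finset (MonicIrreducible F) × {f : F[X] // f.Monic} where
  toFun x := (x.2.1, ⟨x.1.1 /ₘ ∏ P ∈ x.2.1, P.1, by
    have hT := monic_prod_monicIrreducible x.2.1
    obtain ⟨r, hr⟩ := (prod_dvd_iff_subset_primeDivisors x.1.2.ne_zero x.2.1).2
      (Finset.mem_powerset.1 x.2.2)
    have h1 : x.1.1 /ₘ ∏ P ∈ x.2.1, P.1 = r := by
      generalize x.2.1 = T at *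
      rw [hr, mul_divByMonic_cancel_left _ hT]
    rw [h1]
    exact hT.of_mul_monic_left (hr ▸ x.1.2)⟩)
  invFun y := ⟨⟨(∏ P ∈ y.1, P.1) * y.2.1, (monic_prod_monicIrreducible y.1).mul y.2.2⟩, y.1,
    Finset.mem_powerset.2 ((prod_dvd_iff_subset_primeDivisors
      ((monic_prod_monicIrreducible y.1).mul y.2.2).ne_zero y.1).1 (dvd_mul_right _ _))⟩
  left_inv := by
    rintro ⟨⟨f, hf⟩, T, hT⟩
    have hTm := monic_prod_monicIrreducible T
    obtain ⟨r, hr⟩ := (prod_dvd_iff_subset_primeDivisors hf.ne_zero T).2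
      (Finset.mem_powerset.1 hT)
    subst hr
    refine sigma_divisorSet_ext ?_ rfl
    simp only [mul_divByMonic_cancel_left _ hTm]
  right_inv := by
    rintro ⟨T, f, hf⟩
    simp only [mul_divByMonic_cancel_left _ (monic_prod_monicIrreducible T)]

/-- The deviation from `1` of the Euler factor of `P(2)`. -/
def eulerTerm (P : MonicIrreducible F) : ℝ := -1 / (((polyNorm P.1 : ℝ) + 1) * (polyNorm P.1 : ℝ) ^ 2)

theorem summable_norm_eulerTerm : Summable fun P : MonicIrreducible F => ‖eulerTerm P‖ := by
  have hinj : Function.Injective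
      (fun P : MonicIrreducible F => (⟨P.1, P.2.1⟩ : {f : F[X] // f.Monic})) := by
    intro P Q h
    simpa [Subtype.ext_iff] using h
  refine Summable.of_nonneg_of_le (fun _ => norm_nonneg _) (fun P => ?_)
    (summable_one_div_polyNorm_sq.comp_injective hinj)
  have hpos : 0 < (polyNorm P.1 : ℝ) := Nat.cast_pos.2 (polyNorm_pos _)
  rw [eulerTerm, Real.norm_eq_abs, abs_div, abs_neg, abs_one, abs_of_pos (by positivity)]
  simp only [Function.comp_apply]
  refine one_div_le_one_div_of_le (by positivity) ?_
  nlinarith [pow_pos hpos 2]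

theorem prod_eulerTerm_div (T : Finset (MonicIrreducible F)) {r : F[X]} (hr : r.Monic) :
    (∏ P ∈ T, eulerTerm P) * (1 / (polyNorm r : ℝ) ^ 2) =
      (∏ P ∈ T, (-1 / ((polyNorm P.1 : ℝ) + 1))) / (polyNorm ((∏ P ∈ T, P.1) * r) : ℝ) ^ 2 := by
  have h : ∏ P ∈ T, eulerTerm P =
      (∏ P ∈ T, (-1 / ((polyNorm P.1 : ℝ) + 1))) / ∏ P ∈ T, (polyNorm P.1 : ℝ) ^ 2 := by
    rw [← Finset.prod_div_distrib]
    refine Finset.prod_congr rfl fun P _ => ?_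
    rw [eulerTerm, div_mul_eq_div_div]
  rw [h, polyNorm_mul (monic_prod_monicIrreducible T) hr, polyNorm_prod, Nat.cast_mul,
    Nat.cast_prod, mul_pow, ← Finset.prod_pow, div_mul_div_comm, mul_one]

/-- Expand the product of the factors `1 - 1 / (|P| + 1)`. -/
theorem coprimeDensity_eq_sum (f : F[X]) :
    coprimeDensity f = ∑ T ∈ (primeDivisors f).powerset,
      ∏ P ∈ T, (-1 / ((polyNorm P.1 : ℝ) + 1)) := by
  rw [← Finset.prod_one_add, coprimeDensity]
  refine Finset.prod_congr rfl fun P _ => ?_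
  have hpos : 0 < (polyNorm P.1 : ℝ) := Nat.cast_pos.2 (polyNorm_pos _)
  field_simp
  ring

theorem divisorSetEquiv_prod_mul
    (x : Σ f : {f : F[X] // f.Monic}, {T // T ∈ (primeDivisors f.1).powerset}) :
    (∏ P ∈ (divisorSetEquiv F x).1, P.1) * (divisorSetEquiv F x).2.1 = x.1.1 :=
  congrArg (fun y => y.1.1) ((divisorSetEquiv F).symm_apply_apply x)

theorem summable_prod_mul {A B : Type*} {f : A → ℝ} {g : B → ℝ} (hf : Summable f)
    (hg : Summable g) : Summable fun x : A × B => f x.1 * g x.2 :=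
  summable_mul_of_summable_norm hf.norm hg.norm

theorem tsum_mul_tsum_eq_tsum_sigma {A B C : Type*} {s : C → Finset A}
    (e : (Σ c, {a // a ∈ s c}) ≃ A × B) {f : A → ℝ} {g : B → ℝ} (hf : Summable f)
    (hg : Summable g) :
    (∑' a, f a) * ∑' b, g b = ∑' c, ∑ a : {a // a ∈ s c}, f (e ⟨c, a⟩).1 * g (e ⟨c, a⟩).2 := by
  have hs := summable_prod_mul hf hg
  have hs' : Summable fun x => f (e x).1 * g (e x).2 := e.summable_iff.2 hs
  rw [hf.tsum_mul_tsum hg hs, ← e.tsum_eq, hs'.tsum_sigma' fun c => (hasSum_fintype _).summable]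
  exact tsum_congr fun c => tsum_fintype _

/-- Expand the Euler product over finite sets `T` of primes, multiply by the sum over monic `r`, and
group the pairs `(T, r)` by `f = r * ∏ P ∈ T, P`. -/
theorem tsum_coprimeDensity :
    (∑' f : {f : F[X] // f.Monic}, 1 / (polyNorm f.1 : ℝ) ^ 2) *
        ∏' P : MonicIrreducible F, (1 + eulerTerm P) =
      ∑' f : {f : F[X] // f.Monic}, coprimeDensity f.1 / (polyNorm f.1 : ℝ) ^ 2 := by
  have hprod : Summable fun T : Finset (MonicIrreducible F) => ∏ P ∈ T, eulerTerm P :=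
    summable_finsetProd_of_summable_norm summable_norm_eulerTerm
  have hsum := tsum_mul_tsum_eq_tsum_sigma (divisorSetEquiv F) hprod
    (summable_one_div_polyNorm_sq (F := F))
  rw [tprod_one_add hprod, mul_comm, hsum]
  refine tsum_congr fun f => ?_
  calc _ = ∑ T : {T // T ∈ (primeDivisors f.1).powerset},
        (∏ P ∈ T.1, (-1 / ((polyNorm P.1 : ℝ) + 1))) / (polyNorm f.1 : ℝ) ^ 2 := by
        refine Finset.sum_congr rfl fun T _ => ?_
        rw [prod_eulerTerm_div _ (divisorSetEquiv F ⟨f, T⟩).2.2, divisorSetEquiv_prod_mul]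
        rfl
    _ = ∑ T ∈ (primeDivisors f.1).powerset,
        (∏ P ∈ T, (-1 / ((polyNorm P.1 : ℝ) + 1))) / (polyNorm f.1 : ℝ) ^ 2 :=
        Finset.sum_coe_sort (primeDivisors f.1).powerset fun T =>
          (∏ P ∈ T, (-1 / ((polyNorm P.1 : ℝ) + 1))) / (polyNorm f.1 : ℝ) ^ 2
    _ = _ := by rw [coprimeDensity_eq_sum, Finset.sum_div]

theorem summable_coprimeDensity :
    Summable fun f : {f : F[X] // f.Monic} => coprimeDensity f.1 / (polyNorm f.1 : ℝ) ^ 2 :=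
  summable_one_div_polyNorm_sq.of_nonneg_of_le
    (fun f => div_nonneg (coprimeDensity_nonneg _) (by positivity))
    fun f => by gcongr; exact coprimeDensity_le_one _

/-- The term `f = 1` alone is `1`. The constant is thus nonzero, so asymptotic equivalence reduces
to convergence. -/
theorem one_le_tsum_coprimeDensity :
    1 ≤ ∑' f : {f : F[X] // f.Monic}, coprimeDensity f.1 / (polyNorm f.1 : ℝ) ^ 2 := by
  have := summable_coprimeDensity.le_tsum (⟨1, monic_one⟩ : {f : F[X] // f.Monic})
    fun f _ => div_nonneg (coprimeDensity_nonneg _) (by positivity)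
  simpa [coprimeDensity_one, polyNorm] using this

theorem eulerFactor_two (P : MonicIrreducible F) : eulerFactor 2 P = ((1 + eulerTerm P : ℝ) : ℂ) := by
  rw [eulerFactor, eulerTerm, Complex.cpow_ofNat]
  push_cast
  ring

theorem hasProd_eulerFactor_two : HasProd (fun P : MonicIrreducible F => eulerFactor 2 P)
    ((∏' P : MonicIrreducible F, (1 + eulerTerm P) : ℝ) : ℂ) := by
  have := (multipliable_one_add_of_summable_prod
    (summable_finsetProd_of_summable_norm (summable_norm_eulerTerm (F := F)))).hasProd
  have h2 := this.map Complex.ofRealHom Complex.continuous_ofReal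
  simpa [Function.comp_def, eulerFactor_two] using h2

theorem hasSum_zetaA_two :
    HasSum (fun f : {f : F[X] // f.Monic} => 1 / (polyNorm f.1 : ℂ) ^ (2 : ℂ))
      ((∑' f : {f : F[X] // f.Monic}, 1 / (polyNorm f.1 : ℝ) ^ 2 : ℝ) : ℂ) := by
  have := Complex.hasSum_ofReal.2 (summable_one_div_polyNorm_sq (F := F)).hasSum
  simpa [Complex.cpow_ofNat] using this

theorem zetaA_mul_eulerP_two : zetaA F 2 * eulerP F 2 =
    ((∑' f : {f : F[X] // f.Monic}, coprimeDensity f.1 / (polyNorm f.1 : ℝ) ^ 2 : ℝ) : ℂ) := by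
  rw [zetaA, hasSum_zetaA_two.tsum_eq, eulerP, hasProd_eulerFactor_two.tprod_eq,
    ← tsum_coprimeDensity, Complex.ofReal_mul]

/-! ### The mean value and the passage to the limit -/

/-- The sum of `χ_D (f)` over the monic `f` of degree `n`. -/
def charSum (D : F[X]) (n : ℕ) : ℤ := ∑ f ∈ monicOfDegree F n, jac D f

theorem LTerm_one_eq (hF : ringChar F ≠ 2) (D : F[X]) (n : ℕ) :
    LTerm D 1 n = ((charSum D n / (Fintype.card F : ℝ) ^ n : ℝ) : ℂ) := by
  rw [LTerm, charSum]
  push_cast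
  rw [Finset.sum_div]
  refine Finset.sum_congr rfl fun f hf => ?_
  rw [chi_eq_jac hF D (mem_monicOfDegree.1 hf).1, Complex.cpow_one, polyNorm_of_mem hf,
    Nat.cast_pow]

/-- By reciprocity this sums a nontrivial character modulo `D` over complete residue systems. -/
theorem charSum_eq_zero (hq : Fintype.card F % 4 = 1) {g : ℕ} {D : F[X]}
    (hD : D ∈ squarefreeMonic F (2 * g + 1)) {n : ℕ} (hn : 2 * g + 1 ≤ n) : charSum D n = 0 := by
  obtain ⟨hDm, hs⟩ := mem_squarefreeMonic.1 hD
  obtain ⟨hm, hd⟩ := mem_monicOfDegree.1 hDm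
  have hF := ringChar_ne_two_of_card hq
  obtain ⟨P, hP, hi, hPD⟩ := exists_monic_irreducible_dvd hm (by
    rintro rfl; rw [natDegree_one] at hd; omega)
  obtain ⟨b, -, hb⟩ := exists_jac_eq_neg_one_of_sq_not_dvd hF hm hP hi hPD
    fun h => hi.not_isUnit (hs P h)
  rw [charSum, Finset.sum_congr rfl fun f _ => jac_comm hq D f]
  exact sum_jac_eq_zero hm hb (by omega)

/-- The mean value of the `n`-th term of `L(1, χ_D)` over the squarefree `D` of degree `m`. -/
def meanTerm (F : Type*) [Field F] [Fintype F] (m n : ℕ) : ℝ :=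
  (∑ D ∈ squarefreeMonic F m, (charSum D n : ℝ) / (Fintype.card F : ℝ) ^ n) /
    (squarefreeMonic F m).card

/-- Cauchy–Schwarz, then positivity extends the second moment to all monic `D`; the factor `2` is
the cost of replacing `q ^ m` by the square-free count. -/
theorem sq_sum_abs_charSum_le (hF : ringChar F ≠ 2) {m n : ℕ} (h : 2 * n ≤ m) :
    (∑ D ∈ squarefreeMonic F m, |(charSum D n : ℝ)|) ^ 2 ≤
      2 * (n + 1) * (Fintype.card F : ℝ) ^ n * ((squarefreeMonic F m).card : ℝ) ^ 2 := by
  have h1 := sq_sum_le_card_mul_sum_sq (s := squarefreeMonic F m)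
    (f := fun D => |(charSum D n : ℝ)|)
  refine h1.trans ?_
  have h2 : ∑ D ∈ squarefreeMonic F m, charSum D n ^ 2 ≤
      (n + 1) * (Fintype.card F : ℤ) ^ n * (Fintype.card F : ℤ) ^ m :=
    (Finset.sum_le_sum_of_subset_of_nonneg (fun D hD => (mem_squarefreeMonic.1 hD).1)
      fun _ _ _ => sq_nonneg _).trans (sum_sq_sum_jac_le hF h)
  have h3 : ∑ D ∈ squarefreeMonic F m, |(charSum D n : ℝ)| ^ 2 ≤
      (n + 1) * (Fintype.card F : ℝ) ^ n * (Fintype.card F : ℝ) ^ m := by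
    simp only [sq_abs]
    exact_mod_cast h2
  have h4 : (Fintype.card F : ℝ) ^ m ≤ 2 * ((squarefreeMonic F m).card : ℝ) := by
    exact_mod_cast pow_le_two_mul_card_squarefreeMonic (F := F) m
  calc _ ≤ ((squarefreeMonic F m).card : ℝ) *
        ((n + 1) * (Fintype.card F : ℝ) ^ n * (2 * ((squarefreeMonic F m).card : ℝ))) := by
        gcongr
        exact h3.trans (by gcongr)
    _ = _ := by ring

theorem abs_charSum_functional_equation (hq : Fintype.card F % 4 = 1) {g : ℕ} {D : F[X]}
    (hD : D ∈ squarefreeMonic F (2 * g + 1)) {n k : ℕ} (hnk : n + k = 2 * g) :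
    |(charSum D n : ℝ)| / (Fintype.card F : ℝ) ^ n =
      |(charSum D k : ℝ)| / (Fintype.card F : ℝ) ^ g := by
  obtain ⟨hDm, hs⟩ := mem_squarefreeMonic.1 hD
  obtain ⟨hm, hd⟩ := mem_monicOfDegree.1 hDm
  have h := abs_sum_jac_functional_equation hm (ringChar_ne_two_of_card hq) hs hd hnk
  have hsum : ∀ n, charSum D n = ∑ f ∈ monicOfDegree F n, jac f D := fun n =>
    Finset.sum_congr rfl fun f _ => jac_comm hq D f
  rw [← hsum, ← hsum] at h
  have hq0 : (Fintype.card F : ℝ) ≠ 0 := Nat.cast_ne_zero.2 Fintype.card_ne_zero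
  rw [div_eq_div_iff (pow_ne_zero _ hq0) (pow_ne_zero _ hq0), mul_comm |(charSum D k : ℝ)|]
  exact_mod_cast h

theorem abs_meanTerm_le (hq : Fintype.card F % 4 = 1) (g n : ℕ) :
    |meanTerm F (2 * g + 1) n| ≤ √(2 * (n + 1) / (Fintype.card F : ℝ) ^ n) := by
  have hF := ringChar_ne_two_of_card hq
  have hq0 : 0 < (Fintype.card F : ℝ) := Nat.cast_pos.2 Fintype.card_pos
  set N : ℝ := ((squarefreeMonic F (2 * g + 1)).card : ℝ) with hN
  have hN0 : 0 < N := Nat.cast_pos.2 (card_squarefreeMonic_pos _)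
  have habs : |meanTerm F (2 * g + 1) n| ≤
      (∑ D ∈ squarefreeMonic F (2 * g + 1), |(charSum D n : ℝ)| / (Fintype.card F : ℝ) ^ n) / N := by
    rw [meanTerm, abs_div, abs_of_pos hN0]
    gcongr
    refine (Finset.abs_sum_le_sum_abs _ _).trans (le_of_eq ?_)
    exact Finset.sum_congr rfl fun D _ => by rw [abs_div, abs_of_pos (pow_pos hq0 n)]
  refine habs.trans (Real.le_sqrt_of_sq_le ?_)
  rw [div_pow, div_le_iff₀ (by positivity)]
  rcases le_or_gt n g with hn | hn
  · rw [← Finset.sum_div, div_pow, div_le_iff₀ (by positivity)]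
    refine (sq_sum_abs_charSum_le hF (by omega)).trans (le_of_eq ?_)
    rw [← hN]
    field_simp
  · rcases le_or_gt n (2 * g) with hn2 | hn2
    · obtain ⟨k, hk⟩ := Nat.exists_eq_add_of_le hn2
      -- Reflect to `k = 2g - n < g`, where the second moment applies; as `q ^ (2g) = q ^ n * q ^
      -- k`, the same bound results.
      rw [Finset.sum_congr rfl fun D hD => abs_charSum_functional_equation hq hD hk.symm,
        ← Finset.sum_div, div_pow, div_le_iff₀ (by positivity)]
      refine (sq_sum_abs_charSum_le hF (by omega)).trans ?_
      have h1 : ((Fintype.card F : ℝ) ^ g) ^ 2 = (Fintype.card F : ℝ) ^ n * (Fintype.card F : ℝ) ^ k := by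
        rw [← pow_mul, ← pow_add]; congr 1; omega
      have h2 : (k : ℝ) ≤ n := by exact_mod_cast (by omega : k ≤ n)
      rw [h1]
      calc _ ≤ 2 * ((n : ℝ) + 1) * (Fintype.card F : ℝ) ^ k * N ^ 2 := by gcongr
        _ = _ := by field_simp
    · rw [Finset.sum_eq_zero]
      · rw [zero_pow two_ne_zero]; positivity
      · intro D hD
        rw [charSum_eq_zero hq hD (by omega)]
        simp

theorem summable_sqrt_bound (hq : Fintype.card F % 4 = 1) :
    Summable fun n : ℕ => √(2 * (n + 1) / (Fintype.card F : ℝ) ^ n) := by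
  have h2 : 2 < (Fintype.card F : ℝ) := by
    have h1 : 1 < Fintype.card F := Fintype.one_lt_card
    exact_mod_cast (by omega : 2 < Fintype.card F)
  set q := (Fintype.card F : ℝ)
  have hlt : √(2 / q) < 1 := by
    rw [Real.sqrt_lt' one_pos, one_pow, div_lt_one] <;> linarith
  refine Summable.of_nonneg_of_le (fun _ => Real.sqrt_nonneg _) (fun n => ?_)
    ((summable_geometric_of_lt_one (Real.sqrt_nonneg _) hlt).mul_left 2)
  rw [Real.sqrt_le_left (by positivity), mul_pow, ← pow_mul, mul_comm n 2, pow_mul,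
    Real.sq_sqrt (by positivity), div_pow]
  -- Compare with the geometric series `2 * √(2 / q) ^ n`.
  have h3 : (n : ℝ) + 1 ≤ 2 ^ n := by exact_mod_cast Nat.lt_two_pow_self
  rw [← mul_div_assoc]
  gcongr
  nlinarith

open Classical in
/-- The mean value of `χ_D (f)` in the limit. -/
def limitWeight (f : F[X]) : ℝ := if IsSquare f then coprimeDensity f else 0

theorem limitWeight_mul_self (f : F[X]) : limitWeight (f * f) = coprimeDensity f := by
  rw [limitWeight, if_pos ⟨f, rfl⟩, coprimeDensity, primeDivisors_mul_self, coprimeDensity]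

theorem isCoprime_iff_forall_primeDivisors {f D : F[X]} (hf : f.Monic) :
    IsCoprime f D ↔ ∀ P ∈ primeDivisors f, ¬ P.1 ∣ D := by
  classical
  constructor
  · intro h P hP hPD
    exact P.2.2.not_isUnit (h.isUnit_of_dvd' ((mem_primeDivisors hf.ne_zero).1 hP) hPD)
  · intro h
    by_contra hc
    obtain ⟨P, hP, hi, hd⟩ := Polynomial.exists_monic_irreducible_factor (EuclideanDomain.gcd f D)
      (by rwa [EuclideanDomain.gcd_isUnit_iff])
    exact h ⟨P, hP, hi⟩ ((mem_primeDivisors hf.ne_zero).2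
      (hd.trans (EuclideanDomain.gcd_dvd_left _ _))) (hd.trans (EuclideanDomain.gcd_dvd_right _ _))

theorem sum_squarefree_jac_mul_self {f : F[X]} (hf : f.Monic) (m : ℕ) :
    ∑ D ∈ squarefreeMonic F m, jac D (f * f) =
      coprimeCount ((primeDivisors f).map (Function.Embedding.subtype _)) m := by
  classical
  have h : ∀ D, jac D (f * f) =
      if ∀ P ∈ (primeDivisors f).map (Function.Embedding.subtype _), ¬ P ∣ D then 1 else 0 := by
    intro D
    have : (∀ P ∈ (primeDivisors f).map (Function.Embedding.subtype _), ¬ P ∣ D) ↔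
        IsCoprime f D := by
      rw [isCoprime_iff_forall_primeDivisors hf]
      simp
    rw [jac_mul_right D hf hf, ← sq]
    split_ifs with hc
    · exact jac_sq_of_isCoprime hf (this.1 hc)
    · rw [(jac_eq_zero_iff hf).2 (mt this.2 hc), zero_pow two_ne_zero]
  rw [Finset.sum_congr rfl fun D _ => h D, ← Finset.sum_filter, Finset.sum_const, coprimeCount]
  simp

theorem tendsto_sum_squarefree_jac (hF : ringChar F ≠ 2) {f : F[X]} (hf : f.Monic) :
    Filter.Tendsto (fun m => ((∑ D ∈ squarefreeMonic F m, jac D f : ℤ) : ℝ) /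
      (Fintype.card F : ℝ) ^ m) Filter.atTop
      (nhds ((1 - 1 / (Fintype.card F : ℝ)) * limitWeight f)) := by
  classical
  by_cases hsq : IsSquare f
  · obtain ⟨l, rfl⟩ := hsq
    have hl0 : l ≠ 0 := by rintro rfl; exact hf.ne_zero (mul_zero _)
    -- A square root of a monic polynomial need not be monic; it is normalized.
    obtain ⟨l', hl', heq⟩ : ∃ l' : F[X], l'.Monic ∧ l * l = l' * l' := by
      refine ⟨normalize l, monic_normalize hl0, eq_of_monic_of_associated hf
        ((monic_normalize hl0).mul (monic_normalize hl0)) ?_⟩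
      exact (normalize_associated l).symm.mul_mul (normalize_associated l).symm
    rw [heq, limitWeight_mul_self]
    simp only [sum_squarefree_jac_mul_self hl', Int.cast_natCast]
    convert tendsto_coprimeCount ((primeDivisors l').map (Function.Embedding.subtype _)) ?_ using 3
    · rw [Finset.prod_map]; rfl
    · intro P hP
      obtain ⟨Q, -, rfl⟩ := Finset.mem_map.1 hP
      exact Q.2
  · rw [limitWeight, if_neg hsq, mul_zero]
    exact tendsto_sum_squarefree_jac_of_not_isSquare hF hf hsq

/-- The square-free density `1 - 1 / q` occurs in numerator and denominator and cancels. -/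
theorem tendsto_meanTerm (hF : ringChar F ≠ 2) (n : ℕ) :
    Filter.Tendsto (fun m => meanTerm F m n) Filter.atTop
      (nhds (∑ f ∈ monicOfDegree F n, limitWeight f / (polyNorm f : ℝ))) := by
  have hq1 : 1 < (Fintype.card F : ℝ) := by exact_mod_cast Fintype.one_lt_card
  have hc : (1 - 1 / (Fintype.card F : ℝ)) ≠ 0 := by
    have : 1 / (Fintype.card F : ℝ) < 1 := by rw [div_lt_one] <;> linarith
    linarith
  have h : ∀ f ∈ monicOfDegree F n, Filter.Tendsto
      (fun m => ((∑ D ∈ squarefreeMonic F m, jac D f : ℤ) : ℝ) / (Fintype.card F : ℝ) ^ m /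
        (((squarefreeMonic F m).card : ℝ) / (Fintype.card F : ℝ) ^ m) / (polyNorm f : ℝ))
      Filter.atTop (nhds (limitWeight f / (polyNorm f : ℝ))) := by
    intro f hf
    have := ((tendsto_sum_squarefree_jac hF (mem_monicOfDegree.1 hf).1).div
      (tendsto_card_squarefreeMonic (F := F)) hc).div_const (polyNorm f : ℝ)
    rwa [mul_div_cancel_left₀ _ hc] at this
  refine (tendsto_finsetSum _ h).congr fun m => ?_
  rw [meanTerm, ← Finset.sum_div]
  simp only [charSum, Int.cast_sum]
  rw [Finset.sum_comm, Finset.sum_div, Finset.sum_div]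
  refine Finset.sum_congr rfl fun f hf => ?_
  rw [polyNorm_of_mem hf, Nat.cast_pow, div_div_div_cancel_right₀ (by positivity), div_right_comm]

/-- The weight lives on squares, and squaring is injective on monic polynomials, so the sum is
reindexed by the root. -/
theorem hasSum_limitWeight :
    HasSum (fun f : {f : F[X] // f.Monic} => limitWeight f.1 / (polyNorm f.1 : ℝ))
      (∑' f : {f : F[X] // f.Monic}, coprimeDensity f.1 / (polyNorm f.1 : ℝ) ^ 2) := by
  classical
  set s : {f : F[X] // f.Monic} → {f : F[X] // f.Monic} := fun f => ⟨f.1 * f.1, f.2.mul f.2⟩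
  have hinj : Function.Injective s := by
    intro f g h
    have h' : f.1 * f.1 = g.1 * g.1 := congrArg Subtype.val h
    exact Subtype.ext (squarefree_mul_self_unique f.2 g.2 squarefree_one squarefree_one
      (by rw [h'])).2
  refine (hinj.hasSum_iff ?_).1 ?_
  · intro f hf
    have : ¬ IsSquare f.1 := by
      rintro ⟨l, hl⟩
      have hl0 : l ≠ 0 := by rintro rfl; exact f.2.ne_zero (by rw [hl, mul_zero])
      refine hf ⟨⟨normalize l, monic_normalize hl0⟩, Subtype.ext ?_⟩
      refine eq_of_monic_of_associated ((monic_normalize hl0).mul (monic_normalize hl0)) f.2 ?_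
      rw [hl]
      exact (normalize_associated l).mul_mul (normalize_associated l)
    rw [limitWeight, if_neg this, zero_div]
  · have : (fun f : {f : F[X] // f.Monic} => limitWeight f.1 / (polyNorm f.1 : ℝ)) ∘ s =
        fun f => coprimeDensity f.1 / (polyNorm f.1 : ℝ) ^ 2 := by
      funext f
      simp only [Function.comp_apply, s]
      rw [limitWeight_mul_self, polyNorm_mul f.2 f.2, Nat.cast_mul, sq]
    rw [this]
    exact summable_coprimeDensity.hasSum

theorem tsum_sum_limitWeight :
    ∑' n, ∑ f ∈ monicOfDegree F n, limitWeight f / (polyNorm f : ℝ) =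
      ∑' f : {f : F[X] // f.Monic}, coprimeDensity f.1 / (polyNorm f.1 : ℝ) ^ 2 := by
  rw [← hasSum_limitWeight.tsum_eq,
    tsum_monic_eq (φ := fun f => limitWeight f / (polyNorm f : ℝ)) hasSum_limitWeight.summable]

theorem summable_charSum (hq : Fintype.card F % 4 = 1) {g : ℕ} {D : F[X]}
    (hD : D ∈ squarefreeMonic F (2 * g + 1)) :
    Summable fun n => (charSum D n : ℝ) / (Fintype.card F : ℝ) ^ n :=
  summable_of_ne_finset_zero (s := Finset.range (2 * g + 1)) fun n hn => by
    rw [charSum_eq_zero hq hD (by simpa using hn)]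
    simp

theorem summable_LTerm_one (hq : Fintype.card F % 4 = 1) {g : ℕ} {D : F[X]}
    (hD : D ∈ squarefreeMonic F (2 * g + 1)) : Summable (LTerm D 1) := by
  rw [funext (LTerm_one_eq (ringChar_ne_two_of_card hq) D)]
  exact Complex.summable_ofReal.2 (summable_charSum hq hD)

theorem mean_LFunction_one (hq : Fintype.card F % 4 = 1) (g : ℕ) :
    (1 / ((squarefreeMonic F (2 * g + 1)).card : ℂ)) *
      ∑ D ∈ squarefreeMonic F (2 * g + 1), LFunction D 1 =
      ((∑' n, meanTerm F (2 * g + 1) n : ℝ) : ℂ) := by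
  have h : ∀ D ∈ squarefreeMonic F (2 * g + 1), LFunction D 1 =
      ((∑' n, (charSum D n : ℝ) / (Fintype.card F : ℝ) ^ n : ℝ) : ℂ) := by
    intro D _
    rw [LFunction, Complex.ofReal_tsum]
    exact tsum_congr fun n => LTerm_one_eq (ringChar_ne_two_of_card hq) D n
  rw [Finset.sum_congr rfl h, ← Complex.ofReal_sum,
    ← Summable.tsum_finsetSum fun D hD => summable_charSum hq hD]
  simp only [meanTerm]
  rw [tsum_div_const]
  push_cast
  rw [one_div_mul_eq_div]

theorem tendsto_tsum_meanTerm (hq : Fintype.card F % 4 = 1) :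
    Filter.Tendsto (fun g => ∑' n, meanTerm F (2 * g + 1) n) Filter.atTop
      (nhds (∑' f : {f : F[X] // f.Monic}, coprimeDensity f.1 / (polyNorm f.1 : ℝ) ^ 2)) := by
  rw [← tsum_sum_limitWeight]
  refine tendsto_tsum_of_dominated_convergence (summable_sqrt_bound hq) (fun n => ?_)
    (Filter.Eventually.of_forall fun g n => abs_meanTerm_le hq g n)
  refine (tendsto_meanTerm (ringChar_ne_two_of_card hq) n).comp ?_
  exact Filter.tendsto_atTop_mono (fun g => (by omega : g ≤ 2 * g + 1)) Filter.tendsto_id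

end FqT

end

theorem corollary3 {F : Type*} [Field F] [Fintype F] (hq : Fintype.card F % 4 = 1) :
    (∀ (g : ℕ), ∀ D ∈ FqT.squarefreeMonic F (2 * g + 1), Summable (FqT.LTerm D 1)) ∧
    Summable (fun f : {f : F[X] // f.Monic} => 1 / (FqT.polyNorm f.1 : ℂ) ^ (2 : ℂ)) ∧
    Multipliable (fun P : {P : F[X] // P.Monic ∧ Irreducible P} => FqT.eulerFactor 2 P) ∧
    Asymptotics.IsEquivalent Filter.atTop
      (fun g : ℕ =>
        (1 / ((FqT.squarefreeMonic F (2 * g + 1)).card : ℂ)) *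
          ∑ D ∈ FqT.squarefreeMonic F (2 * g + 1), FqT.LFunction D 1)
      (fun _ : ℕ => FqT.zetaA F 2 * FqT.eulerP F 2) := by
  refine ⟨fun g D hD => FqT.summable_LTerm_one hq hD, FqT.hasSum_zetaA_two.summable,
    FqT.hasProd_eulerFactor_two.multipliable, ?_⟩
  rw [FqT.zetaA_mul_eulerP_two]
  refine (Asymptotics.isEquivalent_const_iff_tendsto ?_).2 ?_
  rotate_left
  · simp only [FqT.mean_LFunction_one hq]
    exact (Complex.continuous_ofReal.tendsto _).comp (FqT.tendsto_tsum_meanTerm hq)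
  · exact Complex.ofReal_ne_zero.2 (zero_lt_one.trans_le FqT.one_le_tsum_coprimeDensity).ne'
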